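/- Let $\mathcal H_{UV}=\bigoplus_\alpha \mathcal H_u^\alpha\otimes\mathcal H_{\bar u}^\alpha$ be a finite orthogonal direct sum of tensor products of finite-dimensional complex Hilbert spaces, and let $\mathcal A_u=\bigoplus_\alpha \mathcal B(\mathcal H_u^\alpha)$ and $\mathcal A_{\bar u}=\bigoplus_\alpha\mathcal B(\mathcal H_{\bar u}^\alpha)$ act on $\mathcal H_{UV}$ by $\bigoplus_\alpha x_\alpha\otimes 1$ and $\bigoplus_\alpha 1\otimes y_\alpha$, respectively. For an operator $\rho$ on $\mathcal H_{UV}$ let $\rho_u\in\mathcal A_u$ be its reduction: the block of $\rho_u$ on $\mathcal H_u^\alpha$ is the partial trace over $\mathcal H_{\bar u}^\alpha$ of the $\alpha$-th diagonal block of $\rho$. The inverse of a Hermitian operator means its standard inverse on its support (the orthogonal complement of its kernel), extended by zero on its kernel. For a set $G$ of operators, $\mathrm{vN}(G)$ denotes the (unital) von Neumann algebra generated by $G$. For a subspace $K\subseteq\mathcal H_{UV}$ with maximally mixed state $\sigma=P_K/\dim K$ (and $\sigma=0$ if $K=0$) put $$\mathcal A(K)=\mathrm{vN}\{\rho_u\sigma_u^{-1}:\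 \rho\text{ a density operator on }K\},\qquad E(K)=\mathcal A(K)\cdot K=\mathrm{span}\{X\psi:\ X\in\mathcal A(K),\ \psi\in K\}.$$ If $\mathcal B$ is a von Neumann algebra on a subspace $K\subseteq \mathcal H_{UV}$, we say that a set $\mathcal C$ of operators on $K$ can be recovered from a set $\mathcal D$ of operators on $\mathcal H_{UV}$ if for every $T\in\mathcal C$ there is $X\in\mathcal D$ with $T\psi=X\psi$ and $T^\dagger\psi=X^\dagger\psi$ for all $\psi\in K$; and that $(K,\mathcal B)$ satisfies complementary recovery if $\mathcal B$ can be recovered from $\mathcal A_u$ and the commutant $\mathcal B'$ of $\mathcal B$ in $\mathcal B(K)$ can be recovered from $\mathcal A_{\bar u}$. **Theorem.** Let $S\subseteq\mathcal H_{UV}$ be an arbitrary set of seed states, $\mathcal H_0=\mathrm{span}\,S$ and $\mathcal H_{n+1}=E(\mathcal H_n)$. Then: 1. The sequence $\mathcal H_0\subseteq\mathcal H_1\subseteq\cdots$ is eventually constant; let $\mathcal H_{IR}^{pre}=\bigcup_n\mathcal H_n$ be its final value, and let $\mathcal A_u^{pre}=\mathcal A(\mathcal H_{IR}^{pre})$.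 2. Every operator in $\mathcal A_u^{pre}$ maps $\mathcal H_{IR}^{pre}$ into itself. 3. The set $\mathcal A_r^{pre}$ of restrictions to $\mathcal H_{IR}^{pre}$ of the operators in $\mathcal A_u^{pre}$ is a von Neumann algebra on $\mathcal H_{IR}^{pre}$, and $(\mathcal H_{IR}^{pre},\mathcal A_r^{pre})$ satisfies complementary recovery: $\mathcal A_r^{pre}$ can be recovered from $\mathcal A_u$, and its commutant $\mathcal A_{\bar r}^{pre}$ can be recovered from $\mathcal A_{\bar u}$. 4. $\mathcal H_{IR}^{pre}$ is the smallest such extension of the seed states: among all subspaces $K\subseteq\mathcal H_{UV}$ that contain $S$ and carry some von Neumann algebra $\mathcal B$ such that $(K,\mathcal B)$ satisfies complementary recovery, $\mathcal H_{IR}^{pre}$ is the least one with respect to inclusion. -/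

import Mathlib

open scoped TensorProduct InnerProductSpace

namespace HolographicCode

/-- Finite-dimensional complex inner product spaces are Hilbert spaces. -/
instance instCompleteOfFinite (E : Type*) [NormedAddCommGroup E] [NormedSpace ℂ E]
    [FiniteDimensional ℂ E] : CompleteSpace E :=
  FiniteDimensional.complete ℂ E

section General

variable {H : Type*} [NormedAddCommGroup H] [InnerProductSpace ℂ H] [FiniteDimensional ℂ H]

/-- The von Neumann algebra generated by a set `S` of operators: the double commutant of
`S ∪ S†`. -/
noncomputable def vN (S : Set (H →L[ℂ] H)) : VonNeumannAlgebra H where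
  toStarSubalgebra :=
    StarSubalgebra.centralizer ℂ (StarSubalgebra.centralizer ℂ S : Set (H →L[ℂ] H))
  centralizer_centralizer' := by simp

/-- The inverse of a Hermitian operator `T` on its support: the standard inverse on the
orthogonal complement of the kernel, and zero on the kernel. It is obtained by applying the
real function `x ↦ x⁻¹`, with `0⁻¹ = 0`, to the (finite) spectrum of `T`. -/
noncomputable def supportInverse (T : H →L[ℂ] H) : H →L[ℂ] H :=
  cfc (fun x : ℝ => x⁻¹) T

/-- `ρ` is a density operator on the subspace `K`, regarded as an operator on the ambient space:
it is positive, has trace one, and is supported in `K`. -/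
def IsDensityOperatorOn (K : Submodule ℂ H) (ρ : H →L[ℂ] H) : Prop :=
  ρ.IsPositive ∧ LinearMap.trace ℂ H (ρ : H →ₗ[ℂ] H) = 1 ∧ ∀ ψ, ρ ψ ∈ K

/-- The maximally mixed state on the subspace `K`: the orthogonal projection onto `K` divided by
the dimension of `K`. -/
noncomputable def maximallyMixed (K : Submodule ℂ H) : H →L[ℂ] H :=
  ((Module.finrank ℂ K : ℂ)⁻¹) • K.starProjection

/-- The subspace `A · K` spanned by all the vectors `X ψ` with `X ∈ A` and `ψ ∈ K`. -/
def act (A : VonNeumannAlgebra H) (K : Submodule ℂ H) : Submodule ℂ H :=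
  Submodule.span ℂ {φ | ∃ X ∈ A, ∃ ψ ∈ K, φ = X ψ}

/-- A set `B` of operators on a subspace `K` can be recovered from a set `A` of operators on the
ambient space: each operator in `B` is represented, together with its adjoint, by an operator in
`A`. -/
def RecoverableFrom (K : Submodule ℂ H) (B : Set (K →L[ℂ] K)) (A : Set (H →L[ℂ] H)) : Prop :=
  ∀ T ∈ B, ∃ X ∈ A, ∀ ψ : K,
    (T ψ : H) = X ψ ∧
      (ContinuousLinearMap.adjoint T ψ : H) = ContinuousLinearMap.adjoint X ψ

/-- Complementary recovery, for the algebra `B` on the subspace `K`, with respect to the pair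
`A`, `A'`: `B` is recoverable from `A` and the commutant of `B` is recoverable from `A'`. -/
def ComplementaryRecovery (K : Submodule ℂ H) (B : VonNeumannAlgebra K)
    (A A' : Set (H →L[ℂ] H)) : Prop :=
  RecoverableFrom K (B : Set (K →L[ℂ] K)) A ∧
    RecoverableFrom K (B.commutant : Set (K →L[ℂ] K)) A'

end General

section UV

variable {α : Type*} [Fintype α]
  (Hu : α → Type*) [∀ a, NormedAddCommGroup (Hu a)] [∀ a, InnerProductSpace ℂ (Hu a)]
  [∀ a, FiniteDimensional ℂ (Hu a)]
  (Hub : α → Type*) [∀ a, NormedAddCommGroup (Hub a)] [∀ a, InnerProductSpace ℂ (Hub a)]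
  [∀ a, FiniteDimensional ℂ (Hub a)]

/-- The Hilbert space `⨁ₐ Hu a ⊗ Hub a`. -/
abbrev UVSpace : Type _ := PiLp 2 (fun a => Hu a ⊗[ℂ] Hub a)

variable {Hu Hub}

/-- The operator `⨁ₐ X a` on `⨁ₐ Hu a ⊗ Hub a`. -/
noncomputable def blockDiag (X : ∀ a, Hu a ⊗[ℂ] Hub a →ₗ[ℂ] Hu a ⊗[ℂ] Hub a) :
    UVSpace Hu Hub →L[ℂ] UVSpace Hu Hub :=
  LinearMap.toContinuousLinearMap
    { toFun := fun ψ => WithLp.toLp 2 (fun a => X a (ψ a))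
      map_add' := fun ψ φ => by ext a; simp
      map_smul' := fun c ψ => by ext a; simp }

/-- The operator `⨁ₐ x a ⊗ 1`. -/
noncomputable def leftOp (x : ∀ a, Hu a →ₗ[ℂ] Hu a) : UVSpace Hu Hub →L[ℂ] UVSpace Hu Hub :=
  blockDiag (fun a => TensorProduct.map (x a) LinearMap.id)

/-- The operator `⨁ₐ 1 ⊗ y a`. -/
noncomputable def rightOp (y : ∀ a, Hub a →ₗ[ℂ] Hub a) : UVSpace Hu Hub →L[ℂ] UVSpace Hu Hub :=
  blockDiag (fun a => TensorProduct.map LinearMap.id (y a))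

variable (Hu Hub)

/-- The algebra `A_u = ⨁ₐ B(Hu a)` acting on `⨁ₐ Hu a ⊗ Hub a`. -/
def algU : Set (UVSpace Hu Hub →L[ℂ] UVSpace Hu Hub) := Set.range leftOp

/-- The algebra `A_ū = ⨁ₐ B(Hub a)` acting on `⨁ₐ Hu a ⊗ Hub a`. -/
def algUbar : Set (UVSpace Hu Hub →L[ℂ] UVSpace Hu Hub) := Set.range rightOp

variable {Hu Hub}

/-- The partial trace over the second tensor factor: `∑ⱼ (1 ⊗ ⟨eⱼ|) T (1 ⊗ |eⱼ⟩)` for an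
orthonormal basis `e` of the second factor. -/
noncomputable def partialTrace {E F : Type*}
    [NormedAddCommGroup E] [InnerProductSpace ℂ E] [FiniteDimensional ℂ E]
    [NormedAddCommGroup F] [InnerProductSpace ℂ F] [FiniteDimensional ℂ F]
    (T : E ⊗[ℂ] F →ₗ[ℂ] E ⊗[ℂ] F) : E →ₗ[ℂ] E :=
  ∑ j, (TensorProduct.rid ℂ E).toLinearMap ∘ₗ
    (LinearMap.lTensor E (innerSL ℂ (stdOrthonormalBasis ℂ F j)).toLinearMap) ∘ₗ T ∘ₗ
    ((TensorProduct.mk ℂ E F).flip (stdOrthonormalBasis ℂ F j))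

open scoped Classical in
/-- The diagonal block of `ρ` on the summand `Hu a ⊗ Hub a`. -/
noncomputable def diagBlock (ρ : UVSpace Hu Hub →L[ℂ] UVSpace Hu Hub) (a : α) :
    Hu a ⊗[ℂ] Hub a →ₗ[ℂ] Hu a ⊗[ℂ] Hub a where
  toFun v := ρ (WithLp.toLp 2 (Pi.single a v)) a
  map_add' v w := by simp [Pi.single_add, WithLp.toLp_add]
  map_smul' c v := by simp [Pi.single_smul, WithLp.toLp_smul]

/-- The reduced state `ρ_u` of `ρ`, as an element of `A_u`: its block on `Hu a` is the partial
trace over `Hub a` of the corresponding diagonal block of `ρ`. -/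
noncomputable def reduced (ρ : UVSpace Hu Hub →L[ℂ] UVSpace Hu Hub) :
    UVSpace Hu Hub →L[ℂ] UVSpace Hu Hub :=
  leftOp (fun a => partialTrace (diagBlock ρ a))

/-- The von Neumann algebra generated by the operators `ρ_u σ_u⁻¹`, where `ρ` ranges over the
density operators on `K` and `σ` is the maximally mixed state on `K`. -/
noncomputable def seedAlgebra (K : Submodule ℂ (UVSpace Hu Hub)) :
    VonNeumannAlgebra (UVSpace Hu Hub) :=
  vN {X | ∃ ρ, IsDensityOperatorOn K ρ ∧
    X = reduced ρ * supportInverse (reduced (maximallyMixed K))}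

/-- One step of the construction. -/
noncomputable def enlarge (K : Submodule ℂ (UVSpace Hu Hub)) : Submodule ℂ (UVSpace Hu Hub) :=
  act (seedAlgebra K) K

/-- The space reached after `n` steps, starting from the span of the seed states `S`. -/
noncomputable def stage (S : Set (UVSpace Hu Hub)) (n : ℕ) : Submodule ℂ (UVSpace Hu Hub) :=
  enlarge^[n] (Submodule.span ℂ S)

/-- The space `H_IR^pre` produced by the iteration, i.e. the union of the increasing chain of
stages. -/
noncomputable def preSpace (S : Set (UVSpace Hu Hub)) : Submodule ℂ (UVSpace Hu Hub) :=
  ⨆ n, stage S n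

/-- The algebra `A_u^pre` on the ambient space. -/
noncomputable def preAlgebra (S : Set (UVSpace Hu Hub)) : VonNeumannAlgebra (UVSpace Hu Hub) :=
  seedAlgebra (preSpace S)

end UV

end HolographicCode

set_option linter.unusedSectionVars false

/-! The argument needs only a von Neumann algebra A with a faithful trace φ and, for each ρ, the
density R ρ ∈ A of the functional tr(·ρ) on A (`IsReduction`); `isReduction_reduced` puts A_u in
this setting. Write P for the projection onto K, q = R(P / dim K), and M for the algebra of ratios
on K.

Recovery. If M preserves K, it commutes with P. Let t be an operator on K commuting with M. For δ =
[t, τ] with τ on K, the ratio c = R δ · q⁻¹ lies in M, so tr(c*δ) = 0 by cyclicity; but dim K ·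
tr(c*δ) = tr((cP)*cP), hence cP = 0 and R δ = 0. By duality t commutes with all compressions PxP, x
∈ A (`compression_commute`). Then xPψ ↦ xtψ is well defined on A·K and gives a representative of t
in A' (`exists_commutant_representation`). The same lifting, applied to M', shows that the
restriction of M to K is its own double commutant.

Minimality. If K has complementary recovery, every PyP with y ∈ A equals XP for some X ∈ A commuting
with P. By trace duality R ρ = Xq, with such an X, for every ρ on K. For a subspace L of K, the
factors q in a ratio on L cancel up to the support of q, which contains K; so the ratio commutes
with P (`apply_mem_of_complementaryRecovery`). By induction all stages stay inside K. -/

namespace HolographicCode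

/-! ### The trace form on operators -/

section OperatorTrace

variable {H : Type*} [NormedAddCommGroup H] [InnerProductSpace ℂ H] [FiniteDimensional ℂ H]

/-- The trace of a continuous linear operator. -/
noncomputable def opTrace : (H →L[ℂ] H) →ₗ[ℂ] ℂ :=
  LinearMap.trace ℂ H ∘ₗ ContinuousLinearMap.coeLM ℂ

theorem opTrace_apply (x : H →L[ℂ] H) : opTrace x = LinearMap.trace ℂ H (x : H →ₗ[ℂ] H) := rfl

theorem opTrace_mul_comm (x y : H →L[ℂ] H) : opTrace (x * y) = opTrace (y * x) :=
  LinearMap.trace_mul_comm ℂ (x : H →ₗ[ℂ] H) (y : H →ₗ[ℂ] H)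

/-- The functional `x ↦ tr (w x)`. -/
noncomputable def weightedTrace (w : H →L[ℂ] H) : (H →L[ℂ] H) →ₗ[ℂ] ℂ :=
  opTrace ∘ₗ LinearMap.mulLeft ℂ w

theorem weightedTrace_apply (w x : H →L[ℂ] H) : weightedTrace w x = opTrace (w * x) := rfl

theorem opTrace_eq_sum_inner (x : H →L[ℂ] H) :
    opTrace x = ∑ i, ⟪stdOrthonormalBasis ℂ H i, x (stdOrthonormalBasis ℂ H i)⟫_ℂ :=
  LinearMap.trace_eq_sum_inner (x : H →ₗ[ℂ] H) (stdOrthonormalBasis ℂ H)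

theorem opTrace_star (x : H →L[ℂ] H) : opTrace (star x) = star (opTrace x) := by
  simp only [opTrace_eq_sum_inner, star_sum, ContinuousLinearMap.star_eq_adjoint,
    ContinuousLinearMap.adjoint_inner_right]
  exact Finset.sum_congr rfl fun i _ => (inner_conj_symm _ _).symm

theorem eq_zero_of_opTrace_star_mul_self {x : H →L[ℂ] H} (h : opTrace (star x * x) = 0) :
    x = 0 := by
  have h1 : ∑ i, ‖x (stdOrthonormalBasis ℂ H i)‖ ^ 2 = 0 := by
    have : ((∑ i, ‖x (stdOrthonormalBasis ℂ H i)‖ ^ 2 : ℝ) : ℂ) = 0 := by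
      rw [← h, opTrace_eq_sum_inner]
      push_cast
      refine Finset.sum_congr rfl fun i _ => ?_
      have h2 := ContinuousLinearMap.adjoint_inner_right x (stdOrthonormalBasis ℂ H i)
        (x (stdOrthonormalBasis ℂ H i))
      rw [inner_self_eq_norm_sq_to_K] at h2
      exact h2.symm
    exact_mod_cast this
  rw [Finset.sum_eq_zero_iff_of_nonneg fun i _ => by positivity] at h1
  apply ContinuousLinearMap.coe_injective
  refine (stdOrthonormalBasis ℂ H).toBasis.ext fun i => ?_
  simpa using h1 i (Finset.mem_univ i)

theorem eq_zero_of_opTrace_eq_zero {x : H →L[ℂ] H} (h : x.IsPositive) (h0 : opTrace x = 0) :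
    x = 0 := by
  obtain ⟨y, rfl⟩ := CStarAlgebra.nonneg_iff_eq_star_mul_self.mp
    ((ContinuousLinearMap.nonneg_iff_isPositive x).mpr h)
  rw [eq_zero_of_opTrace_star_mul_self h0, mul_zero]

/-- The trace form is nondegenerate on a star-closed space of operators, so that every
trace functional on it is represented by one of its elements. -/
theorem exists_mem_forall_opTrace_eq (V : Submodule ℂ (H →L[ℂ] H))
    (hV : ∀ x ∈ V, star x ∈ V) (ρ : H →L[ℂ] H) :
    ∃ b ∈ V, ∀ c ∈ V, opTrace (b * c) = opTrace (ρ * c) := by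
  let Φ : (H →L[ℂ] H) →ₗ[ℂ] Module.Dual ℂ V :=
    LinearMap.mk₂ ℂ (fun (b : H →L[ℂ] H) (c : V) => opTrace (b * (c : H →L[ℂ] H)))
      (fun a b c => by rw [add_mul, map_add]) (fun r b c => by rw [smul_mul_assoc, map_smul])
      (fun b c d => by rw [Submodule.coe_add, mul_add, map_add])
      (fun r b c => by rw [Submodule.coe_smul, mul_smul_comm, map_smul])
  -- Testing b against b* ∈ V gives injectivity; V and its dual have equal dimension, so
  -- surjectivity follows.
  have hinj : Function.Injective (Φ ∘ₗ V.subtype) := by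
    rw [← LinearMap.ker_eq_bot, LinearMap.ker_eq_bot']
    intro b hb
    have h1 : opTrace ((b : H →L[ℂ] H) * star (b : H →L[ℂ] H)) = 0 :=
      LinearMap.congr_fun hb ⟨star (b : H →L[ℂ] H), hV _ b.2⟩
    rw [opTrace_mul_comm] at h1
    exact Subtype.ext (eq_zero_of_opTrace_star_mul_self h1)
  have hsurj : Function.Surjective (Φ ∘ₗ V.subtype) :=
    (LinearMap.injective_iff_surjective_of_finrank_eq_finrank
      Subspace.dual_finrank_eq.symm).mp hinj
  obtain ⟨b, hb⟩ := hsurj (Φ ρ)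
  exact ⟨b, b.2, fun c hc => LinearMap.congr_fun hb ⟨c, hc⟩⟩

end OperatorTrace

/-! ### Inverse on the support -/

section SupportInverse

variable {H : Type*} [NormedAddCommGroup H] [InnerProductSpace ℂ H] [FiniteDimensional ℂ H]

/-- Finiteness makes every function continuous on the spectrum, even x ↦ x⁻¹ when 0 is an
eigenvalue, so the functional calculus in `supportInverse` is meaningful. -/
theorem finite_real_spectrum (T : H →L[ℂ] H) : (spectrum ℝ T).Finite := by
  rw [← spectrum.preimage_algebraMap ℂ]
  refine Set.Finite.preimage (algebraMap ℝ ℂ).injective.injOn ?_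
  rw [← AlgEquiv.spectrum_eq (Module.End.toContinuousLinearMap (𝕜 := ℂ) H).symm]
  exact Module.End.finite_spectrum _

theorem isSelfAdjoint_supportInverse (T : H →L[ℂ] H) : IsSelfAdjoint (supportInverse T) :=
  cfc_predicate _ _

theorem commute_supportInverse {T x : H →L[ℂ] H} (hT : IsSelfAdjoint T) (h : Commute T x) :
    Commute (supportInverse T) x :=
  hT.commute_cfc h _

theorem mul_supportInverse_mul {T : H →L[ℂ] H} (hT : IsSelfAdjoint T) :
    T * supportInverse T * T = T := by
  have hc : ∀ f : ℝ → ℝ, ContinuousOn f (spectrum ℝ T) :=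
    fun f => (finite_real_spectrum T).continuousOn f
  have h1 := cfc_mul (fun x : ℝ => x) (fun x : ℝ => x⁻¹) T (hc _) (hc _)
  have h2 := cfc_mul (fun x : ℝ => x * x⁻¹) (fun x : ℝ => x) T (hc _) (hc _)
  rw [h1, cfc_id' ℝ T] at h2
  rw [supportInverse, ← h2]
  simp only [mul_inv_mul_cancel]
  exact cfc_id' ℝ T

theorem supportInverse_mul_mul {T : H →L[ℂ] H} (hT : IsSelfAdjoint T) :
    supportInverse T * T * supportInverse T = supportInverse T := by
  have hc : ∀ f : ℝ → ℝ, ContinuousOn f (spectrum ℝ T) :=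
    fun f => (finite_real_spectrum T).continuousOn f
  have h1 := cfc_mul (fun x : ℝ => x⁻¹) (fun x : ℝ => x) T (hc _) (hc _)
  have h2 := cfc_mul (fun x : ℝ => x⁻¹ * x) (fun x : ℝ => x⁻¹) T (hc _) (hc _)
  rw [h1, cfc_id' ℝ T] at h2
  rw [supportInverse, ← h2]
  congr 1
  funext x
  rcases eq_or_ne x 0 with rfl | hx
  · simp
  · field_simp

/-- This is uniqueness of the group inverse: commutation forces ST = S'T, and then S = STS = S'TS' =
S'. -/
theorem eq_supportInverse {T S : H →L[ℂ] H} (hT : IsSelfAdjoint T) (hc : Commute T S)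
    (h1 : T * S * T = T) (h2 : S * T * S = S) : S = supportInverse T := by
  set S' := supportInverse T
  have hc' : Commute T S' := (commute_supportInverse hT (.refl T)).symm
  have h1' : T * S' * T = T := mul_supportInverse_mul hT
  have h2' : S' * T * S' = S' := supportInverse_mul_mul hT
  have key : S * T = S' * T := by
    calc S * T = T * S := hc.eq.symm
      _ = T * S' * T * S := by rw [h1']
      _ = S' * T * T * S := by rw [hc'.eq]
      _ = S' * (T * (T * S)) := by simp only [mul_assoc]
      _ = S' * (T * S * T) := by rw [mul_assoc T S T, ← hc.eq]
      _ = S' * T := by rw [h1]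
  calc S = S * T * S := h2.symm
    _ = S' * (T * S) := by rw [key, mul_assoc]
    _ = S' * (S' * T) := by rw [hc.eq, key]
    _ = S' * T * S' := by rw [mul_assoc, hc'.eq]
    _ = S' := h2'

theorem supportInverse_mul {T X : H →L[ℂ] H} (hT : IsSelfAdjoint T) (hX : IsSelfAdjoint X)
    (h : Commute X T) : supportInverse (X * T) = supportInverse X * supportInverse T := by
  have hXi : Commute (supportInverse X) T := commute_supportInverse hX h
  have hTi : Commute (supportInverse T) X := commute_supportInverse hT h.symm
  have hXX : Commute (supportInverse X) X := commute_supportInverse hX (.refl X)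
  have hTT : Commute (supportInverse T) T := commute_supportInverse hT (.refl T)
  have hii : Commute (supportInverse X) (supportInverse T) := commute_supportInverse hX hTi.symm
  refine (eq_supportInverse ((IsSelfAdjoint.commute_iff hX hT).mp h) ?_ ?_ ?_).symm
  · exact (hXX.symm.mul_left hXi.symm).mul_right (hTi.symm.mul_left hTT.symm)
  · calc X * T * (supportInverse X * supportInverse T) * (X * T)
        = X * (T * supportInverse X) * (supportInverse T * X) * T := by simp only [mul_assoc]
      _ = (X * supportInverse X) * (T * X) * supportInverse T * T := by
          rw [hTi.eq, ← hXi.eq]; simp only [mul_assoc]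
      _ = (X * supportInverse X * X) * (T * supportInverse T * T) := by
          rw [← h.eq]; simp only [mul_assoc]
      _ = X * T := by rw [mul_supportInverse_mul hX, mul_supportInverse_mul hT]
  · calc supportInverse X * supportInverse T * (X * T) * (supportInverse X * supportInverse T)
        = supportInverse X * (supportInverse T * X) * (T * supportInverse X) * supportInverse T
          := by simp only [mul_assoc]
      _ = supportInverse X * X * (supportInverse T * supportInverse X) * T * supportInverse T
          := by rw [hTi.eq, ← hXi.eq]; simp only [mul_assoc]
      _ = (supportInverse X * X * supportInverse X) *
            (supportInverse T * T * supportInverse T) := by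
          rw [← hii.eq]; simp only [mul_assoc]
      _ = supportInverse X * supportInverse T := by
          rw [supportInverse_mul_mul hX, supportInverse_mul_mul hT]

end SupportInverse

/-! ### Lifting to the commutant -/

section Representation

variable {H : Type*} [NormedAddCommGroup H] [InnerProductSpace ℂ H] [FiniteDimensional ℂ H]

/-- If `P x P` commutes with `t = P t P` for every `x` in a star algebra `A`, where `P` is the
projection onto `K`, then `t` is represented on `K`, together with its adjoint, by an operator
in the commutant of `A`. -/
theorem exists_commutant_representation (A : StarSubalgebra ℂ (H →L[ℂ] H)) (K : Submodule ℂ H)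
    {t : H →L[ℂ] H} (ht : K.starProjection * t = t) (ht' : t * K.starProjection = t)
    (h : ∀ x ∈ A, K.starProjection * x * t = t * x * K.starProjection) :
    ∃ Y : H →L[ℂ] H, (∀ x ∈ A, x * Y = Y * x) ∧ Y * K.starProjection = t ∧
      K.starProjection * Y = t := by
  set P := K.starProjection with hP
  have hPsa : star P = P := isSelfAdjoint_starProjection K
  -- F and G below send x ⊗ ψ to xPψ and xtψ; the wanted operator is G ∘ F⁻¹ on the range A·K of F.
  let F₀ (s : H →L[ℂ] H) : A →ₗ[ℂ] H →ₗ[ℂ] H :=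
    LinearMap.mk₂ ℂ (fun (x : A) (ψ : H) => (x : H →L[ℂ] H) (s ψ))
      (fun a b c => by simp) (fun r b c => by simp) (fun b c d => by simp)
      (fun r b c => by simp)
  let F : A ⊗[ℂ] H →ₗ[ℂ] H := TensorProduct.lift (F₀ P)
  let G : A ⊗[ℂ] H →ₗ[ℂ] H := TensorProduct.lift (F₀ t)
  have hF (x : A) (ψ : H) : F (x ⊗ₜ ψ) = (x : H →L[ℂ] H) (P ψ) := rfl
  have hG (x : A) (ψ : H) : G (x ⊗ₜ ψ) = (x : H →L[ℂ] H) (t ψ) := rfl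
  have hPG (y : A) (z : A ⊗[ℂ] H) :
      P ((y : H →L[ℂ] H) (G z)) = t ((y : H →L[ℂ] H) (F z)) := by
    induction z with
    | zero => simp
    | add a b ha hb => simp [ha, hb]
    | tmul x ψ =>
      have := congr($(h _ (mul_mem y.2 x.2)) ψ)
      simpa [hF, hG] using this
  -- Well-definedness: moving x across the inner product produces P x* G z = t x* F z = 0.
  have hinner (z z' : A ⊗[ℂ] H) (hz : F z = 0) : ⟪G z', G z⟫_ℂ = 0 := by
    induction z' with
    | zero => simp
    | add a b ha hb => rw [map_add, inner_add_left, ha, hb, add_zero]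
    | tmul x ψ =>
      have h1 := hPG (star x) z
      rw [hz, map_zero, map_zero] at h1
      have h2 : P (t ψ) = t ψ := congr($ht ψ)
      rw [hG, ← ContinuousLinearMap.adjoint_inner_right, ← h2,
        ← ContinuousLinearMap.adjoint_inner_right P]
      have h3 : ContinuousLinearMap.adjoint P = P := hPsa
      have h4 : ContinuousLinearMap.adjoint (x : H →L[ℂ] H) = ((star x : A) : H →L[ℂ] H) := rfl
      rw [h3, h4, h1, inner_zero_right]
  have hker : F.ker ≤ G.ker := fun z hz => inner_self_eq_zero.mp (hinner z z hz)
  obtain ⟨Y₀, hY₀⟩ : ∃ Y₀ : H →ₗ[ℂ] H, ∀ z, Y₀ (F z) = G z := by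
    obtain ⟨g, hg⟩ := ((F.ker.liftQ G hker) ∘ₗ F.quotKerEquivRange.symm.toLinearMap).exists_extend
    refine ⟨g, fun z => ?_⟩
    have := LinearMap.congr_fun hg ⟨F z, z, rfl⟩
    simp only [LinearMap.comp_apply, Submodule.subtype_apply] at this
    rw [this]
    have h5 : F.quotKerEquivRange.symm ⟨F z, z, rfl⟩ = F.ker.mkQ z := by
      rw [LinearEquiv.symm_apply_eq]; rfl
    simp [h5]
  have hxF (x : A) (z : A ⊗[ℂ] H) : ∃ z', F z' = (x : H →L[ℂ] H) (F z) ∧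
      G z' = (x : H →L[ℂ] H) (G z) := by
    induction z with
    | zero => exact ⟨0, by simp⟩
    | add a b ha hb =>
      obtain ⟨a', ha⟩ := ha
      obtain ⟨b', hb⟩ := hb
      exact ⟨a' + b', by simp [ha, hb]⟩
    | tmul y ψ => exact ⟨(x * y) ⊗ₜ ψ, by simp [hF, hG]⟩
  -- A·K is invariant under the star algebra A, so Q commutes with A, and extending by zero off A·K
  -- keeps Y in the commutant.
  set Q := F.range.starProjection with hQ
  have hQr (v : H) : ∃ z, F z = Q v := F.range.starProjection_apply_mem v
  have hQsa : star Q = Q := isSelfAdjoint_starProjection _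
  have hQx (x : A) : (x : H →L[ℂ] H) * Q = Q * x := by
    have h1 (x : A) : Q * x * Q = x * Q := by
      ext v
      obtain ⟨z, hz⟩ := hQr v
      obtain ⟨z', hz', -⟩ := hxF x z
      simp only [mul_apply_eq_comp]
      rw [← hz, ← hz']
      exact Submodule.starProjection_eq_self_iff.mpr ⟨z', rfl⟩
    have h2 := congr(star $(h1 (star x)))
    simp only [star_mul, hQsa, StarMemClass.coe_star, star_star, ← mul_assoc] at h2
    rw [← h1, h2]
  have hQP : Q * P = P := by
    ext v
    exact Submodule.starProjection_eq_self_iff.mpr ⟨1 ⊗ₜ v, by simp [hF]⟩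
  have hPQ : P * Q = P := by
    have := congr(star $hQP)
    rwa [star_mul, hPsa, hQsa] at this
  refine ⟨LinearMap.toContinuousLinearMap Y₀ * Q, fun x hx => ?_, ?_, ?_⟩
  · lift x to A using hx
    rw [mul_assoc, ← hQx]
    ext v
    obtain ⟨z, hz⟩ := hQr v
    obtain ⟨z', hz', hz''⟩ := hxF x z
    simp [← hz, ← hz', hY₀, hz'']
  · rw [mul_assoc, hQP]
    ext v
    have := hY₀ (1 ⊗ₜ v)
    simpa [hF, hG] using this
  · have h6 : t * Q = t := by rw [← ht', mul_assoc, hPQ]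
    rw [← h6]
    ext v
    obtain ⟨z, hz⟩ := hQr v
    have := hPG 1 z
    simp only [OneMemClass.coe_one, one_apply_eq_self] at this
    simp [← hz, hY₀, this]

end Representation
-- Operators on a subspace and their extension by zero
section Compression

variable {H : Type*} [NormedAddCommGroup H] [InnerProductSpace ℂ H] [FiniteDimensional ℂ H]
  {K : Submodule ℂ H}

theorem star_starProjection (K : Submodule ℂ H) : star K.starProjection = K.starProjection :=
  isSelfAdjoint_starProjection K

theorem starProjection_mul_self (K : Submodule ℂ H) :
    K.starProjection * K.starProjection = K.starProjection :=
  K.isIdempotentElem_starProjection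

theorem starProjection_mul_eq_iff {x : H →L[ℂ] H} :
    K.starProjection * x = x ↔ ∀ ψ, x ψ ∈ K := by
  simp [ContinuousLinearMap.ext_iff, Submodule.starProjection_eq_self_iff]

/-- An operator on `K`, extended by zero to the ambient space. -/
noncomputable def extendByZero (T : K →L[ℂ] K) : H →L[ℂ] H :=
  K.subtypeL ∘L T ∘L K.orthogonalProjectionOnto

/-- The compression to `K` of an operator on the ambient space. -/
noncomputable def compression (K : Submodule ℂ H) (x : H →L[ℂ] H) : K →L[ℂ] K :=
  K.orthogonalProjectionOnto ∘L x ∘L K.subtypeL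

theorem extendByZero_apply (T : K →L[ℂ] K) (ψ : H) :
    extendByZero T ψ = T (K.orthogonalProjectionOnto ψ) := rfl

@[simp]
theorem extendByZero_coe (T : K →L[ℂ] K) (ψ : K) : extendByZero T (ψ : H) = T ψ := by
  simp [extendByZero_apply]

theorem extendByZero_injective : Function.Injective (extendByZero (K := K)) := by
  intro S T h
  ext ψ
  simpa using congr($h (ψ : H))

theorem extendByZero_mul (S T : K →L[ℂ] K) :
    extendByZero (S * T) = extendByZero S * extendByZero T := by
  ext ψ
  simp [extendByZero_apply]

theorem starProjection_mul_extendByZero (T : K →L[ℂ] K) :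
    K.starProjection * extendByZero T = extendByZero T :=
  starProjection_mul_eq_iff.mpr fun _ => Subtype.prop _

theorem extendByZero_mul_starProjection (T : K →L[ℂ] K) :
    extendByZero T * K.starProjection = extendByZero T := by
  ext ψ
  have h : K.orthogonalProjectionOnto (K.starProjection ψ) = K.orthogonalProjectionOnto ψ :=
    K.orthogonalProjectionOnto_mem_subspace_eq_self (K.orthogonalProjectionOnto ψ)
  simp [extendByZero_apply, h]

theorem extendByZero_star (T : K →L[ℂ] K) : extendByZero (star T) = star (extendByZero T) := by
  simp only [extendByZero, ContinuousLinearMap.star_eq_adjoint, ContinuousLinearMap.adjoint_comp,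
    Submodule.adjoint_subtypeL, Submodule.adjoint_orthogonalProjectionOnto]
  rfl

theorem extendByZero_compression (x : H →L[ℂ] H) :
    extendByZero (compression K x) = K.starProjection * x * K.starProjection := rfl

theorem mul_starProjection_eq_extendByZero_iff {X : H →L[ℂ] H} {T : K →L[ℂ] K} :
    X * K.starProjection = extendByZero T ↔ ∀ ψ : K, (T ψ : H) = X ψ := by
  constructor
  · intro h ψ
    simpa using congr($h.symm (ψ : H))
  · intro h
    ext ψ
    rw [extendByZero_apply, h]
    rfl

/-- The condition on adjoints, X*P = T*, turns into PX = T after taking stars. -/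
theorem recoverableFrom_iff {B : Set (K →L[ℂ] K)} {A : Set (H →L[ℂ] H)} :
    RecoverableFrom K B A ↔ ∀ T ∈ B, ∃ X ∈ A,
      X * K.starProjection = extendByZero T ∧ K.starProjection * X = extendByZero T := by
  refine forall₂_congr fun T _ => exists_congr fun X => and_congr_right fun _ => ?_
  rw [forall_and, ← mul_starProjection_eq_extendByZero_iff,
    ← mul_starProjection_eq_extendByZero_iff (X := ContinuousLinearMap.adjoint X),
    ← ContinuousLinearMap.star_eq_adjoint, ← ContinuousLinearMap.star_eq_adjoint,
    extendByZero_star, ← star_inj (x := K.starProjection * X), star_mul, star_starProjection]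

end Compression

/-! ### Generated von Neumann algebras -/

section GeneratedAlgebra

variable {H : Type*} [NormedAddCommGroup H] [InnerProductSpace ℂ H] [FiniteDimensional ℂ H]

/-- The commutant of G ∪ G* is star-closed, so one commutation relation per Z suffices. -/
theorem mem_vN_iff {G : Set (H →L[ℂ] H)} {X : H →L[ℂ] H} :
    X ∈ vN G ↔ ∀ Z, (∀ g ∈ G, g * Z = Z * g ∧ star g * Z = Z * star g) → Z * X = X * Z := by
  have h : X ∈ vN G ↔ X ∈ StarSubalgebra.centralizer ℂ
      (StarSubalgebra.centralizer ℂ G : Set (H →L[ℂ] H)) := Iff.rfl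
  rw [h, StarSubalgebra.mem_centralizer_iff]
  constructor
  · intro h Z hZ
    exact (h Z ((StarSubalgebra.mem_centralizer_iff ℂ).mpr hZ)).1
  · intro h Z hZ
    exact ⟨h Z ((StarSubalgebra.mem_centralizer_iff ℂ).mp hZ),
      h _ ((StarSubalgebra.mem_centralizer_iff ℂ).mp (star_mem (SetLike.mem_coe.mp hZ)))⟩

theorem subset_vN {G : Set (H →L[ℂ] H)} {g : H →L[ℂ] H} (hg : g ∈ G) : g ∈ vN G :=
  mem_vN_iff.mpr fun _ h => (h g hg).1.symm

theorem mem_of_commute_commutant {A : VonNeumannAlgebra H} {X : H →L[ℂ] H}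
    (h : ∀ Z ∈ A.commutant, Z * X = X * Z) : X ∈ A := by
  rw [← A.commutant_commutant]
  exact VonNeumannAlgebra.mem_commutant_iff.mpr h

theorem mem_of_mem_vN {A : VonNeumannAlgebra H} {G : Set (H →L[ℂ] H)} (hG : G ⊆ A)
    {X : H →L[ℂ] H} (hX : X ∈ vN G) : X ∈ A := by
  refine mem_of_commute_commutant fun Z hZ => mem_vN_iff.mp hX Z fun g hg => ?_
  rw [VonNeumannAlgebra.mem_commutant_iff] at hZ
  exact ⟨hZ g (hG hg), hZ _ (star_mem (hG hg : g ∈ A))⟩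

theorem supportInverse_mem {A : VonNeumannAlgebra H} {T : H →L[ℂ] H} (hT : IsSelfAdjoint T)
    (hTA : T ∈ A) : supportInverse T ∈ A := by
  refine mem_of_commute_commutant fun Z hZ => ?_
  exact (commute_supportInverse hT (VonNeumannAlgebra.mem_commutant_iff.mp hZ T hTA)).symm.eq

theorem smul_mem_vonNeumannAlgebra (A : VonNeumannAlgebra H) (c : ℂ) {X : H →L[ℂ] H}
    (hX : X ∈ A) : c • X ∈ A :=
  A.toStarSubalgebra.smul_mem hX c

/-- A von Neumann algebra leaving `K` invariant commutes with the projection onto `K`. -/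
theorem commute_starProjection_of_invariant {A : VonNeumannAlgebra H} {K : Submodule ℂ H}
    (h : ∀ X ∈ A, ∀ ψ ∈ K, X ψ ∈ K) {X : H →L[ℂ] H} (hX : X ∈ A) :
    X * K.starProjection = K.starProjection * X := by
  have h1 : ∀ X ∈ A, K.starProjection * (X * K.starProjection) = X * K.starProjection :=
    fun X hX => starProjection_mul_eq_iff.mpr fun ψ => h X hX _ (K.starProjection_apply_mem ψ)
  have h2 := congr(star $(h1 _ (star_mem hX)))
  simp only [star_mul, star_starProjection, star_star] at h2
  rw [← h1 X hX, ← mul_assoc, h2]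

theorem apply_mem_of_commute_starProjection {K : Submodule ℂ H} {X : H →L[ℂ] H}
    (h : X * K.starProjection = K.starProjection * X) {ψ : H} (hψ : ψ ∈ K) : X ψ ∈ K := by
  have h1 := congr($h ψ)
  simp only [mul_apply_eq_comp,
    Submodule.starProjection_eq_self_iff.mpr hψ] at h1
  rw [h1]
  exact K.starProjection_apply_mem _

end GeneratedAlgebra

/-! ### Abstract reductions and the algebra of ratios -/

section Reduction

variable {H : Type*} [NormedAddCommGroup H] [InnerProductSpace ℂ H] [FiniteDimensional ℂ H]

/-- `R ρ` is the element of the von Neumann algebra `A` which represents, through the faithful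
tracial functional `φ`, the expectation values of the elements of `A` in `ρ`. -/
structure IsReduction (A : VonNeumannAlgebra H) (φ : (H →L[ℂ] H) →ₗ[ℂ] ℂ)
    (R : (H →L[ℂ] H) → (H →L[ℂ] H)) : Prop where
  mem : ∀ ρ, R ρ ∈ A
  opTrace_mul : ∀ x ∈ A, ∀ ρ, opTrace (x * ρ) = φ (x * R ρ)
  faithful : ∀ x ∈ A, φ (star x * x) = 0 → x = 0
  tracial : ∀ x ∈ A, ∀ y ∈ A, φ (x * y) = φ (y * x)
  map_star : ∀ x ∈ A, φ (star x) = star (φ x)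

/-- The von Neumann algebra generated by the operators `(R ρ) (R σ)⁻¹`, where `ρ` ranges over the
density operators on `K` and `σ` is the maximally mixed state on `K`. -/
noncomputable def ratioAlgebra (R : (H →L[ℂ] H) → (H →L[ℂ] H)) (K : Submodule ℂ H) :
    VonNeumannAlgebra H :=
  vN {X | ∃ ρ, IsDensityOperatorOn K ρ ∧ X = R ρ * supportInverse (R (maximallyMixed K))}

theorem isSelfAdjoint_maximallyMixed (K : Submodule ℂ H) : star (maximallyMixed K) =
    maximallyMixed K := by
  simp [maximallyMixed, star_smul, star_starProjection]

/-- For K = ⊥ both sides vanish, so the zero subspace needs no separate treatment later. -/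
theorem finrank_smul_maximallyMixed (K : Submodule ℂ H) :
    (Module.finrank ℂ K : ℂ) • maximallyMixed K = K.starProjection := by
  by_cases h : Module.finrank ℂ K = 0
  · have : K = ⊥ := Submodule.finrank_eq_zero.mp h
    subst this
    simp [maximallyMixed]
  · rw [maximallyMixed, smul_smul, mul_inv_cancel₀ (by exact_mod_cast h), one_smul]

open scoped ComplexOrder in
/-- Density operators on `K` span the operators `P x P`, with `P` the projection onto `K`. -/
theorem compression_induction (K : Submodule ℂ H) (p : Submodule ℂ (H →L[ℂ] H))
    (hp : ∀ ρ, IsDensityOperatorOn K ρ → ρ ∈ p) (x : H →L[ℂ] H) :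
    K.starProjection * x * K.starProjection ∈ p := by
  have hx : x ∈ Submodule.span ℂ {a : H →L[ℂ] H | 0 ≤ a} := by
    rw [CStarAlgebra.span_nonneg]; trivial
  induction hx using Submodule.span_induction with
  | zero => simp
  | add a b _ _ ha hb => simpa [mul_add, add_mul] using p.add_mem ha hb
  | smul c a _ ha => simpa using p.smul_mem c ha
  | mem a ha =>
    set y := K.starProjection * a * K.starProjection with hy
    have hypos : y.IsPositive := by
      rw [← ContinuousLinearMap.nonneg_iff_isPositive]
      have := star_left_conjugate_nonneg (show 0 ≤ a from ha) K.starProjection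
      rwa [star_starProjection] at this
    -- A positive operator of trace zero vanishes; any other one is a multiple of a density
    -- operator.
    by_cases h0 : opTrace y = 0
    · rw [eq_zero_of_opTrace_eq_zero hypos h0]
      exact p.zero_mem
    · have hre : 0 ≤ (opTrace y)⁻¹ := by
        refine inv_nonneg_of_nonneg ?_
        rw [opTrace_eq_sum_inner]
        exact Finset.sum_nonneg fun i _ => hypos.inner_nonneg_right _
      have := p.smul_mem (opTrace y) (hp ((opTrace y)⁻¹ • y) ⟨?_, ?_, ?_⟩)
      · rwa [smul_smul, mul_inv_cancel₀ h0, one_smul] at this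
      · exact hypos.smul_of_nonneg hre
      · rw [← opTrace_apply, map_smul, smul_eq_mul, inv_mul_cancel₀ h0]
      · intro ψ
        exact K.smul_mem _ (K.starProjection_apply_mem _)

namespace IsReduction

variable {A : VonNeumannAlgebra H} {φ : (H →L[ℂ] H) →ₗ[ℂ] ℂ} {R : (H →L[ℂ] H) → (H →L[ℂ] H)}

/-- Faithfulness applied with x = (r - s)*. This uniqueness yields the algebraic rules for R. -/
theorem eq_of_forall (h : IsReduction A φ R) {r s : H →L[ℂ] H} (hr : r ∈ A) (hs : s ∈ A)
    (hrs : ∀ x ∈ A, φ (x * r) = φ (x * s)) : r = s := by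
  rw [← sub_eq_zero]
  refine h.faithful _ (sub_mem hr hs) ?_
  rw [mul_sub, map_sub, sub_eq_zero]
  exact hrs _ (star_mem (sub_mem hr hs))

theorem eq_of_opTrace (h : IsReduction A φ R) {ρ r : H →L[ℂ] H} (hr : r ∈ A)
    (hρ : ∀ x ∈ A, opTrace (x * ρ) = φ (x * r)) : R ρ = r :=
  h.eq_of_forall (h.mem ρ) hr fun x hx => by rw [← h.opTrace_mul x hx, hρ x hx]

theorem congr_opTrace (h : IsReduction A φ R) {ρ τ : H →L[ℂ] H}
    (hρ : ∀ x ∈ A, opTrace (x * ρ) = opTrace (x * τ)) : R ρ = R τ :=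
  h.eq_of_opTrace (h.mem τ) fun x hx => by rw [hρ x hx, h.opTrace_mul x hx]

theorem map_add (h : IsReduction A φ R) (ρ τ : H →L[ℂ] H) : R (ρ + τ) = R ρ + R τ :=
  h.eq_of_opTrace (add_mem (h.mem ρ) (h.mem τ)) fun x hx => by
    simp [mul_add, h.opTrace_mul x hx]

theorem map_smul (h : IsReduction A φ R) (c : ℂ) (ρ : H →L[ℂ] H) : R (c • ρ) = c • R ρ :=
  h.eq_of_opTrace (smul_mem_vonNeumannAlgebra A c (h.mem ρ)) fun x hx => by
    simp [h.opTrace_mul x hx]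

theorem map_zero (h : IsReduction A φ R) : R 0 = 0 := by
  simpa using h.map_smul 0 0

theorem map_mul_left (h : IsReduction A φ R) {b : H →L[ℂ] H} (hb : b ∈ A) (ρ : H →L[ℂ] H) :
    R (b * ρ) = b * R ρ :=
  h.eq_of_opTrace (mul_mem hb (h.mem ρ)) fun x hx => by
    rw [← mul_assoc, h.opTrace_mul _ (mul_mem hx hb), mul_assoc]

/-- Cyclicity of both `opTrace` and φ carries b around; with `map_mul_left`, R is an A-bimodule map.
-/
theorem map_mul_right (h : IsReduction A φ R) {b : H →L[ℂ] H} (hb : b ∈ A) (ρ : H →L[ℂ] H) :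
    R (ρ * b) = R ρ * b :=
  h.eq_of_opTrace (mul_mem (h.mem ρ) hb) fun x hx => by
    rw [← mul_assoc, opTrace_mul_comm, ← mul_assoc, h.opTrace_mul _ (mul_mem hb hx), mul_assoc,
      h.tracial b hb _ (mul_mem hx (h.mem ρ)), mul_assoc]

theorem star_map (h : IsReduction A φ R) (ρ : H →L[ℂ] H) : star (R ρ) = R (star ρ) := by
  refine (h.eq_of_opTrace (star_mem (h.mem ρ)) fun x hx => ?_).symm
  have h1 : star x * R ρ ∈ A := mul_mem (star_mem hx) (h.mem ρ)
  rw [h.tracial x hx _ (star_mem (h.mem ρ))]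
  have h2 : star (R ρ) * x = star (star x * R ρ) := by simp
  have h3 : x * star ρ = star (ρ * star x) := by simp
  rw [h2, h.map_star _ h1, ← h.opTrace_mul _ (star_mem hx), h3, opTrace_star,
    opTrace_mul_comm]

theorem isSelfAdjoint_map_maximallyMixed (h : IsReduction A φ R) (K : Submodule ℂ H) :
    IsSelfAdjoint (R (maximallyMixed K)) := by
  rw [IsSelfAdjoint, h.star_map, isSelfAdjoint_maximallyMixed]

theorem supportInverse_map_mem (h : IsReduction A φ R) (K : Submodule ℂ H) :
    supportInverse (R (maximallyMixed K)) ∈ A :=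
  supportInverse_mem (h.isSelfAdjoint_map_maximallyMixed K) (h.mem _)

/-- The support of the reduction of the maximally mixed state on `K` contains `K`. -/
theorem starProjection_mul_support (h : IsReduction A φ R) (K : Submodule ℂ H) :
    K.starProjection * (R (maximallyMixed K) * supportInverse (R (maximallyMixed K))) =
      K.starProjection := by
  set q := R (maximallyMixed K) with hq
  have hqsa : IsSelfAdjoint q := h.isSelfAdjoint_map_maximallyMixed K
  set s := q * supportInverse q with hs
  have hsA : s ∈ A := mul_mem (h.mem _) (h.supportInverse_map_mem K)
  have hssa : star s = s := by
    rw [hs, star_mul, (isSelfAdjoint_supportInverse q).star_eq, hqsa.star_eq]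
    exact (commute_supportInverse hqsa (.refl q)).eq
  have hsq : (1 - s) * q = 0 := by
    rw [sub_mul, one_mul, hs, mul_supportInverse_mul hqsa, sub_self]
  -- As 1 - s ∈ A, the trace of (1 - s)P(1 - s) is dim K · φ((1 - s)²q) = 0.
  have h1 : K.starProjection * (1 - s) = 0 := by
    apply eq_zero_of_opTrace_star_mul_self
    rw [star_mul, star_sub, star_one, hssa, star_starProjection, mul_assoc,
      ← mul_assoc K.starProjection, starProjection_mul_self, ← mul_assoc, opTrace_mul_comm,
      ← mul_assoc, ← finrank_smul_maximallyMixed K, mul_smul_comm, _root_.map_smul,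
      h.opTrace_mul _ (mul_mem (sub_mem (one_mem A) hsA) (sub_mem (one_mem A) hsA)), mul_assoc,
      ← hq, hsq, mul_zero, _root_.map_zero, smul_zero]
  rw [mul_sub, mul_one, sub_eq_zero] at h1
  exact h1.symm

theorem support_mul_starProjection (h : IsReduction A φ R) (K : Submodule ℂ H) :
    R (maximallyMixed K) * supportInverse (R (maximallyMixed K)) * K.starProjection =
      K.starProjection := by
  have h1 := congr(star $(h.starProjection_mul_support K))
  have hqsa := h.isSelfAdjoint_map_maximallyMixed K
  rwa [star_mul, star_mul, hqsa.star_eq, (isSelfAdjoint_supportInverse _).star_eq,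
    star_starProjection, (commute_supportInverse hqsa (.refl _)).eq] at h1

theorem map_mul_support (h : IsReduction A φ R) {K : Submodule ℂ H} {τ : H →L[ℂ] H}
    (hτ : τ * K.starProjection = τ) :
    R τ * (supportInverse (R (maximallyMixed K)) * R (maximallyMixed K)) = R τ := by
  have hqsa := h.isSelfAdjoint_map_maximallyMixed K
  rw [(commute_supportInverse hqsa (.refl _)).eq,
    ← h.map_mul_right (mul_mem (h.mem _) (h.supportInverse_map_mem K)), ← hτ, mul_assoc,
    h.starProjection_mul_support]

theorem ratioAlgebra_le (h : IsReduction A φ R) {K : Submodule ℂ H} {X : H →L[ℂ] H}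
    (hX : X ∈ ratioAlgebra R K) : X ∈ A := by
  refine mem_of_mem_vN ?_ hX
  rintro _ ⟨ρ, -, rfl⟩
  exact mul_mem (h.mem ρ) (h.supportInverse_map_mem K)

/-- Density operators span the operators on K and R is linear. The extension is needed for
commutators, which are not states. -/
theorem map_mul_supportInverse_mem (h : IsReduction A φ R) (K : Submodule ℂ H) {τ : H →L[ℂ] H}
    (h1 : K.starProjection * τ = τ) (h2 : τ * K.starProjection = τ) :
    R τ * supportInverse (R (maximallyMixed K)) ∈ ratioAlgebra R K := by
  let p : Submodule ℂ (H →L[ℂ] H) :=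
    { carrier := {τ | R τ * supportInverse (R (maximallyMixed K)) ∈ ratioAlgebra R K}
      add_mem' := fun {a b} ha hb => by
        simpa only [Set.mem_ofPred_eq, h.map_add, add_mul] using add_mem ha hb
      zero_mem' := by
        simp only [Set.mem_ofPred_eq, h.map_zero, zero_mul, zero_mem]
      smul_mem' := fun c a ha => by
        simpa only [Set.mem_ofPred_eq, h.map_smul, smul_mul_assoc] using
          smul_mem_vonNeumannAlgebra _ c ha }
  have h3 := compression_induction K p (fun ρ hρ => subset_vN ⟨ρ, hρ, rfl⟩) τ
  rwa [h1, h2] at h3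

/-- If the ratio algebra leaves `K` invariant, then an operator on `K` commuting with it also
commutes with the compressions to `K` of all the elements of `A`. -/
theorem compression_commute (h : IsReduction A φ R) {K : Submodule ℂ H} {t : H →L[ℂ] H}
    (ht : K.starProjection * t = t) (ht' : t * K.starProjection = t)
    (htM : ∀ a ∈ ratioAlgebra R K, a * t = t * a) {x : H →L[ℂ] H} (hx : x ∈ A) :
    K.starProjection * x * t = t * x * K.starProjection := by
  set P := K.starProjection with hP
  set q := R (maximallyMixed K) with hq
  have key (τ : H →L[ℂ] H) (h1 : P * τ = τ) (h2 : τ * P = τ) : R (t * τ - τ * t) = 0 := by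
    set δ := t * τ - τ * t with hδ
    have hδ1 : P * δ = δ := by rw [hδ, mul_sub, ← mul_assoc, ← mul_assoc, ht, h1]
    have hδ2 : δ * P = δ := by rw [hδ, sub_mul, mul_assoc, mul_assoc, ht', h2]
    set c := R δ * supportInverse q with hc
    have hcM : c ∈ ratioAlgebra R K := h.map_mul_supportInverse_mem K hδ1 hδ2
    have hcq : c * q = R δ := by rw [hc, mul_assoc, h.map_mul_support hδ2]
    have hcA := h.ratioAlgebra_le hcM
    -- c* ∈ M commutes with t, so cyclicity cancels the two terms of the commutator.
    have h3 : opTrace (star c * δ) = 0 := by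
      rw [hδ, mul_sub, _root_.map_sub, ← mul_assoc, htM _ (star_mem hcM), ← mul_assoc,
        opTrace_mul_comm (star c * τ), mul_assoc, sub_self]
    -- Since cq = R δ, the trace of (cP)*cP is dim K · tr(c*δ).
    have h4 : c * P = 0 := by
      apply eq_zero_of_opTrace_star_mul_self
      rw [star_mul, star_starProjection, mul_assoc, opTrace_mul_comm, mul_assoc, mul_assoc,
        starProjection_mul_self, ← mul_assoc, ← finrank_smul_maximallyMixed K, mul_smul_comm,
        _root_.map_smul, h.opTrace_mul _ (mul_mem (star_mem hcA) hcA), ← hq, mul_assoc, hcq,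
        ← h.opTrace_mul _ (star_mem hcA), h3, smul_zero]
    have h5 : c * maximallyMixed K = 0 := by
      rw [maximallyMixed, mul_smul_comm, ← hP, h4, smul_zero]
    rw [← hcq, hq, ← h.map_mul_left hcA, h5, h.map_zero]
  set z := P * x * t - t * x * P with hz
  have hz1 : P * z = z := by
    rw [hz, mul_sub]
    simp only [← mul_assoc]
    rw [hP, starProjection_mul_self, ← hP, ht]
  have hz2 : z * P = z := by
    rw [hz, sub_mul, mul_assoc _ t, ht', mul_assoc _ P P, hP, starProjection_mul_self]
  have hz1' : star z * P = star z := by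
    have := congr(star $hz1); rwa [star_mul, star_starProjection] at this
  have hz2' : P * star z = star z := by
    have := congr(star $hz2); rwa [star_mul, star_starProjection] at this
  -- The choice τ = z* works because tr(z*z) = tr(x[t, z*]).
  have h6 := key (star z) hz2' hz1'
  have h7 : opTrace (x * (t * star z - star z * t)) = 0 := by
    rw [h.opTrace_mul x hx, h6, mul_zero, _root_.map_zero]
  have h8 : z = 0 := by
    apply eq_zero_of_opTrace_star_mul_self
    rw [← h7, hz, mul_sub, mul_sub, _root_.map_sub, _root_.map_sub, ← hz]
    congr 1
    · rw [← mul_assoc, ← mul_assoc, hz1', mul_assoc, opTrace_mul_comm, mul_assoc]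
    · rw [← mul_assoc, opTrace_mul_comm, ← mul_assoc, ← mul_assoc, ← mul_assoc, hz2',
        opTrace_mul_comm, mul_assoc]
  exact sub_eq_zero.mp h8

/-- If the ratio algebra leaves `K` invariant, then its restriction to `K` is a von Neumann
algebra with complementary recovery. -/
theorem exists_restriction_complementaryRecovery (h : IsReduction A φ R) {K : Submodule ℂ H}
    (hK : ∀ X ∈ ratioAlgebra R K, ∀ ψ ∈ K, X ψ ∈ K) :
    ∃ B : VonNeumannAlgebra K,
      (∀ T : K →L[ℂ] K, T ∈ B ↔ ∃ X ∈ ratioAlgebra R K, ∀ ψ : K, (T ψ : H) = X ψ) ∧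
      ComplementaryRecovery K B (A : Set (H →L[ℂ] H)) (A.commutant : Set (H →L[ℂ] H)) := by
  set P := K.starProjection with hP
  have hMP : ∀ X ∈ ratioAlgebra R K, X * P = P * X :=
    fun X hX => commute_starProjection_of_invariant hK hX
  have hres (X : H →L[ℂ] H) (hX : X ∈ ratioAlgebra R K) :
      extendByZero (compression K X) = X * P := by
    rw [extendByZero_compression, ← hMP X hX, mul_assoc, starProjection_mul_self]
  have hresmem (X : H →L[ℂ] H) (hX : X ∈ ratioAlgebra R K) (ψ : K) :
      (compression K X ψ : H) = X ψ :=
    mul_starProjection_eq_extendByZero_iff.mp (hres X hX).symm ψ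
  let G : Set (K →L[ℂ] K) := {T | ∃ X ∈ ratioAlgebra R K, ∀ ψ : K, (T ψ : H) = X ψ}
  have hcomm {T : K →L[ℂ] K} (hT : ∀ S ∈ G, S * T = T * S) (X : H →L[ℂ] H)
      (hX : X ∈ ratioAlgebra R K) : X * extendByZero T = extendByZero T * X := by
    have h1 := congr(extendByZero $(hT (compression K X) ⟨X, hX, hresmem X hX⟩))
    rwa [extendByZero_mul, extendByZero_mul, hres X hX, mul_assoc,
      starProjection_mul_extendByZero, hMP X hX, ← mul_assoc,
      extendByZero_mul_starProjection] at h1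
  have hB (T : K →L[ℂ] K) : T ∈ vN G ↔ T ∈ G := by
    refine ⟨fun hT => ?_, fun hT => subset_vN hT⟩
    -- Compressions of M' commute with G, hence with T; the lifting then represents T by an element
    -- of M'' = M.
    have hcompr (x : H →L[ℂ] H) (hx : x ∈ (ratioAlgebra R K).commutant) :
        P * x * extendByZero T = extendByZero T * x * P := by
      rw [VonNeumannAlgebra.mem_commutant_iff] at hx
      have h1 := mem_vN_iff.mp hT (compression K x) fun S hS => ?_
      · have h2 := congr(extendByZero $h1)
        rwa [extendByZero_mul, extendByZero_mul, extendByZero_compression, mul_assoc,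
          starProjection_mul_extendByZero, ← mul_assoc, ← mul_assoc,
          extendByZero_mul_starProjection] at h2
      · obtain ⟨X, hX, hSX⟩ := hS
        have hSX' := mul_starProjection_eq_extendByZero_iff.mpr hSX
        have h3 (X : H →L[ℂ] H) (hX : X ∈ ratioAlgebra R K) (S : K →L[ℂ] K)
            (hSX : X * P = extendByZero S) : S * compression K x = compression K x * S := by
          apply extendByZero_injective
          rw [extendByZero_mul, extendByZero_mul, extendByZero_compression, ← hSX, ← hP,
            mul_assoc X, ← mul_assoc P, ← mul_assoc P, starProjection_mul_self, ← hP,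
            mul_assoc _ P (X * P), hMP X hX, ← mul_assoc P P, starProjection_mul_self, ← hP,
            ← hMP X hX, ← mul_assoc _ X, mul_assoc P x X, ← hx X hX, ← mul_assoc, ← mul_assoc,
            ← mul_assoc, hMP X hX]
        refine ⟨h3 X hX S hSX', h3 (star X) (star_mem hX) (star S) ?_⟩
        rw [extendByZero_star, ← hSX', star_mul, hP, star_starProjection, ← hP,
          hMP _ (star_mem hX)]
    obtain ⟨Y, hYc, hY, -⟩ := exists_commutant_representation
      (ratioAlgebra R K).commutant.toStarSubalgebra K (starProjection_mul_extendByZero T)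
      (extendByZero_mul_starProjection T) hcompr
    exact ⟨Y, mem_of_commute_commutant hYc, mul_starProjection_eq_extendByZero_iff.mp hY⟩
  refine ⟨vN G, hB, recoverableFrom_iff.mpr fun T hT => ?_,
    recoverableFrom_iff.mpr fun T hT => ?_⟩
  · obtain ⟨X, hX, hTX⟩ := (hB T).mp hT
    have hTX' := mul_starProjection_eq_extendByZero_iff.mpr hTX
    exact ⟨X, h.ratioAlgebra_le hX, hTX', by rw [← hTX', ← hMP X hX]⟩
  · have hT' := VonNeumannAlgebra.mem_commutant_iff.mp (SetLike.mem_coe.mp hT)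
    have hTc := hcomm fun S hS => hT' S ((hB S).mpr hS)
    obtain ⟨Y, hYc, hY⟩ := exists_commutant_representation A.toStarSubalgebra K
      (starProjection_mul_extendByZero T) (extendByZero_mul_starProjection T)
      fun x hx => h.compression_commute (starProjection_mul_extendByZero T)
        (extendByZero_mul_starProjection T) hTc hx
    exact ⟨Y, VonNeumannAlgebra.mem_commutant_iff.mpr hYc, hY⟩

/-- If `K` carries an algebra with complementary recovery, then it is invariant under the ratio
algebras of all its subspaces. -/
theorem apply_mem_of_complementaryRecovery (h : IsReduction A φ R) {K L : Submodule ℂ H}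
    {B : VonNeumannAlgebra K}
    (hB : ComplementaryRecovery K B (A : Set (H →L[ℂ] H)) (A.commutant : Set (H →L[ℂ] H)))
    (hLK : L ≤ K) {X : H →L[ℂ] H} (hX : X ∈ ratioAlgebra R L) {ψ : H} (hψ : ψ ∈ K) :
    X ψ ∈ K := by
  set P := K.starProjection with hP
  have hPP : P * P = P := starProjection_mul_self K
  have hPs : star P = P := star_starProjection K
  set q := R (maximallyMixed K) with hq
  have hqsa : IsSelfAdjoint q := h.isSelfAdjoint_map_maximallyMixed K
  have hBu := recoverableFrom_iff.mp hB.1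
  have hBub := recoverableFrom_iff.mp hB.2
  -- V is B extended by zero, described through representatives in A.
  let V : Submodule ℂ (H →L[ℂ] H) :=
    { carrier := {v | ∃ X ∈ A, X * P = P * X ∧ v = X * P}
      add_mem' := by
        rintro _ _ ⟨X, hX, hXP, rfl⟩ ⟨Y, hY, hYP, rfl⟩
        exact ⟨X + Y, add_mem hX hY, by rw [add_mul, mul_add, hXP, hYP], by rw [add_mul]⟩
      zero_mem' := ⟨0, zero_mem A, by simp, by simp⟩
      smul_mem' := by
        rintro c _ ⟨X, hX, hXP, rfl⟩
        exact ⟨c • X, smul_mem_vonNeumannAlgebra A c hX,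
          by rw [smul_mul_assoc, mul_smul_comm, hXP], by rw [smul_mul_assoc]⟩ }
  have hstar {X : H →L[ℂ] H} (hXP : X * P = P * X) : star X * P = P * star X := by
    have := congr(star $hXP)
    rw [star_mul, star_mul, hPs] at this
    exact this.symm
  have hVstar : ∀ v ∈ V, star v ∈ V := by
    rintro _ ⟨X, hX, hXP, rfl⟩
    exact ⟨star X, star_mem hX, hstar hXP, by rw [star_mul, hPs, hstar hXP]⟩
  -- Representatives of B' commute with y, so PyP commutes with B' and lies in B'' = B, which is
  -- recoverable from A.
  have hVcompr (y : H →L[ℂ] H) (hy : y ∈ A) : P * y * P ∈ V := by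
    have h1 : compression K y ∈ B := by
      refine mem_of_commute_commutant fun T hT => extendByZero_injective ?_
      obtain ⟨Y, hY, hYT, hTY⟩ := hBub T hT
      have hYy := VonNeumannAlgebra.mem_commutant_iff.mp (SetLike.mem_coe.mp hY) y hy
      calc extendByZero (T * compression K y) = extendByZero T * P * y * P := by
            rw [extendByZero_mul, extendByZero_compression, ← mul_assoc, ← mul_assoc]
        _ = P * (Y * y) * P := by
            rw [extendByZero_mul_starProjection, ← hTY, ← mul_assoc]
        _ = P * y * (P * (Y * P)) := by
            rw [← hYy, hYT, starProjection_mul_extendByZero, ← hYT]; simp only [hP, mul_assoc]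
        _ = extendByZero (compression K y * T) := by
            rw [extendByZero_mul, extendByZero_compression, hYT, mul_assoc (P * y)]
    obtain ⟨X, hX, hXT, hTX⟩ := hBu _ h1
    exact ⟨X, hX, by rw [hXT, hTX], by rw [hXT, extendByZero_compression]⟩
  have hqcomm {X : H →L[ℂ] H} (hX : X ∈ A) (hXP : X * P = P * X) : X * q = q * X := by
    rw [hq, ← h.map_mul_left hX, ← h.map_mul_right hX, maximallyMixed, mul_smul_comm, ← hP, hXP,
      smul_mul_assoc]
  -- XP represents the trace functional of ρ on V. As V contains all PyP, ρ and XP agree on A, so R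
  -- ρ = R(XP) = X R(P) = dim K · Xq.
  have hfactor (ρ : H →L[ℂ] H) (hρ : P * ρ * P = ρ) :
      ∃ X ∈ A, X * P = P * X ∧ R ρ = X * q := by
    obtain ⟨_, ⟨X, hX, hXP, rfl⟩, hb⟩ := exists_mem_forall_opTrace_eq V hVstar ρ
    have h1 : R ρ = R (X * P) := by
      refine h.congr_opTrace fun y hy => ?_
      have h2 := hb _ (hVcompr y hy)
      have h3 (ρ : H →L[ℂ] H) (hρ : P * ρ * P = ρ) :
          opTrace (ρ * (P * y * P)) = opTrace (y * ρ) := by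
        rw [← mul_assoc, opTrace_mul_comm, ← mul_assoc, ← mul_assoc, hρ,
          opTrace_mul_comm]
      rw [← h3 ρ hρ, ← h2, h3 (X * P)]
      rw [← mul_assoc, ← hXP, mul_assoc, hPP, mul_assoc, hPP]
    refine ⟨(Module.finrank ℂ K : ℂ) • X, smul_mem_vonNeumannAlgebra A _ hX,
      by rw [smul_mul_assoc, mul_smul_comm, hXP], ?_⟩
    rw [h1, h.map_mul_left hX, hP, ← finrank_smul_maximallyMixed K, h.map_smul, mul_smul_comm,
      smul_mul_assoc]
  have hsub (ρ : H →L[ℂ] H) (h1 : L.starProjection * ρ = ρ) (h2 : star ρ = ρ) :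
      P * ρ * P = ρ := by
    have h3 : P * ρ = ρ :=
      starProjection_mul_eq_iff.mpr fun ψ => hLK (starProjection_mul_eq_iff.mp h1 ψ)
    have h4 := congr(star $h3)
    rw [star_mul, hPs, h2] at h4
    rw [h3, h4]
  set σ := R (maximallyMixed L) with hσ
  have hσsa : IsSelfAdjoint σ := h.isSelfAdjoint_map_maximallyMixed L
  obtain ⟨X₀, hX₀, hX₀P, hX₀σ⟩ := hfactor (maximallyMixed L) (hsub _
    (by rw [maximallyMixed, mul_smul_comm, starProjection_mul_self])
    (isSelfAdjoint_maximallyMixed L))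
  -- The self-adjoint part of X₀ still gives σ, since σ is self-adjoint and q commutes with X₀*;
  -- self-adjointness lets the inverse of Zq factor.
  obtain ⟨Z, hZ, hZP, hZsa, hZσ⟩ : ∃ Z ∈ A, Z * P = P * Z ∧ IsSelfAdjoint Z ∧ σ = Z * q := by
    refine ⟨(2⁻¹ : ℂ) • (X₀ + star X₀), smul_mem_vonNeumannAlgebra A _
      (add_mem hX₀ (star_mem hX₀)), ?_, ?_, ?_⟩
    · rw [smul_mul_assoc, mul_smul_comm, add_mul, mul_add, hX₀P, hstar hX₀P]
    · simp [IsSelfAdjoint, star_smul, add_comm]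
    · have h5 : star X₀ * q = σ := by
        rw [hqcomm (star_mem hX₀) (hstar hX₀P), ← hσsa.star_eq, hσ, hX₀σ, star_mul, hqsa.star_eq]
      rw [smul_mul_assoc, add_mul, h5, ← hX₀σ, ← hσ, ← two_smul ℂ σ, smul_smul]
      simp
  have hinv : supportInverse σ = supportInverse Z * supportInverse q := by
    rw [hZσ, supportInverse_mul hqsa hZsa (hqcomm hZ hZP)]
  have hZi : supportInverse Z ∈ A := supportInverse_mem hZsa hZ
  have hZiP : supportInverse Z * P = P * supportInverse Z := commute_supportInverse hZsa hZP
  refine apply_mem_of_commute_starProjection (Eq.symm ?_) hψ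
  refine mem_vN_iff.mp hX P ?_
  rintro g ⟨ρ, ⟨hρpos, -, hρL⟩, rfl⟩
  -- The q from R ρ meets the q⁻¹ from σ⁻¹, leaving the support projection of q, which P absorbs.
  have hg : R ρ * supportInverse σ * P = P * (R ρ * supportInverse σ) := by
    obtain ⟨W, hW, hWP, hWρ⟩ := hfactor ρ
      (hsub ρ (starProjection_mul_eq_iff.mpr hρL) hρpos.isSelfAdjoint)
    have h6 : R ρ * supportInverse σ = W * supportInverse Z * (q * supportInverse q) := by
      rw [hWρ, hinv, mul_assoc W, ← mul_assoc q, ← hqcomm hZi hZiP]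
      simp only [mul_assoc]
    rw [h6, mul_assoc, h.support_mul_starProjection, ← hP, ← mul_assoc P, ← mul_assoc P, ← hWP,
      mul_assoc W P, ← hZiP, mul_assoc, mul_assoc, mul_assoc, h.starProjection_mul_support]
  exact ⟨hg, hstar hg⟩

end IsReduction
end Reduction
-- Commutants and partial trace on a tensor product
section TensorFactor

variable {E F : Type*} [NormedAddCommGroup E] [InnerProductSpace ℂ E] [FiniteDimensional ℂ E]
  [NormedAddCommGroup F] [InnerProductSpace ℂ F] [FiniteDimensional ℂ F]

theorem exists_linearMap_apply_eq_one [Nontrivial F] : ∃ (f : F) (l : F →ₗ[ℂ] ℂ), l f = 1 := by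
  obtain ⟨f, hf⟩ := exists_ne (0 : F)
  refine ⟨f, (⟪f, f⟫_ℂ)⁻¹ • (innerSL ℂ f).toLinearMap, ?_⟩
  simp [hf]

/-- An operator on `E ⊗ F` commuting with all the operators `1 ⊗ y` has the form `x ⊗ 1`. -/
theorem exists_eq_map_id_of_commute {Z : E ⊗[ℂ] F →ₗ[ℂ] E ⊗[ℂ] F}
    (h : ∀ (y : F →ₗ[ℂ] F) (w : E ⊗[ℂ] F), Z (TensorProduct.map LinearMap.id y w) =
      TensorProduct.map LinearMap.id y (Z w)) :
    ∃ x : E →ₗ[ℂ] E, Z = TensorProduct.map x LinearMap.id := by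
  rcases subsingleton_or_nontrivial F with hF | hF
  · refine ⟨0, TensorProduct.ext' fun e f => ?_⟩
    simp [Subsingleton.elim f 0]
  obtain ⟨f, l, hl⟩ := exists_linearMap_apply_eq_one (F := F)
  let c : E ⊗[ℂ] F →ₗ[ℂ] E := (TensorProduct.rid ℂ E).toLinearMap ∘ₗ LinearMap.lTensor E l
  have hc (g : F) (w : E ⊗[ℂ] F) :
      TensorProduct.map LinearMap.id (l.smulRight g) w = c w ⊗ₜ g := by
    induction w with
    | zero => simp
    | add a b ha hb => simp only [map_add, ha, hb, TensorProduct.add_tmul]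
    | tmul e f' => simp [c, TensorProduct.smul_tmul]
  refine ⟨c ∘ₗ Z ∘ₗ (TensorProduct.mk ℂ E F).flip f, TensorProduct.ext' fun e g => ?_⟩
  -- The rank-one operator l(·)g sends e ⊗ f to e ⊗ g, as l f = 1, so commutation determines Z(e ⊗
  -- g).
  have h1 := h (l.smulRight g) (e ⊗ₜ f)
  rw [hc, hc] at h1
  simpa [c, hl] using h1

/-- An operator on `E ⊗ F` commuting with all the operators `x ⊗ 1` has the form `1 ⊗ y`. -/
theorem exists_eq_id_map_of_commute {Z : E ⊗[ℂ] F →ₗ[ℂ] E ⊗[ℂ] F}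
    (h : ∀ (x : E →ₗ[ℂ] E) (w : E ⊗[ℂ] F), Z (TensorProduct.map x LinearMap.id w) =
      TensorProduct.map x LinearMap.id (Z w)) :
    ∃ y : F →ₗ[ℂ] F, Z = TensorProduct.map LinearMap.id y := by
  rcases subsingleton_or_nontrivial E with hE | hE
  · refine ⟨0, TensorProduct.ext' fun e f => ?_⟩
    simp [Subsingleton.elim e 0]
  obtain ⟨e, l, hl⟩ := exists_linearMap_apply_eq_one (F := E)
  let c : E ⊗[ℂ] F →ₗ[ℂ] F := (TensorProduct.lid ℂ F).toLinearMap ∘ₗ LinearMap.rTensor F l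
  have hc (g : E) (w : E ⊗[ℂ] F) :
      TensorProduct.map (l.smulRight g) LinearMap.id w = g ⊗ₜ c w := by
    induction w with
    | zero => simp
    | add a b ha hb => simp only [map_add, ha, hb, TensorProduct.tmul_add]
    | tmul e f' => simp [c, TensorProduct.smul_tmul]
  refine ⟨c ∘ₗ Z ∘ₗ TensorProduct.mk ℂ E F e, TensorProduct.ext' fun g f => ?_⟩
  have h1 := h (l.smulRight g) (e ⊗ₜ f)
  rw [hc, hc] at h1
  simpa [c, hl] using h1

/-- Cyclicity moves each slice 1 ⊗ ⟨eⱼ| behind 1 ⊗ |eⱼ⟩, and these products sum to the identity. -/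
theorem trace_partialTrace (Z : E ⊗[ℂ] F →ₗ[ℂ] E ⊗[ℂ] F) :
    LinearMap.trace ℂ E (partialTrace Z) = LinearMap.trace ℂ (E ⊗[ℂ] F) Z := by
  set b := stdOrthonormalBasis ℂ F
  let r (j) : E ⊗[ℂ] F →ₗ[ℂ] E := (TensorProduct.rid ℂ E).toLinearMap ∘ₗ
    LinearMap.lTensor E (innerSL ℂ (b j)).toLinearMap
  let i (j) : E →ₗ[ℂ] E ⊗[ℂ] F := (TensorProduct.mk ℂ E F).flip (b j)
  have h1 : partialTrace Z = ∑ j, r j ∘ₗ (Z ∘ₗ i j) := rfl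
  have h2 : ∑ j, i j ∘ₗ r j = LinearMap.id := by
    refine TensorProduct.ext' fun e f => ?_
    have h3 := b.sum_repr' f
    simp only [LinearMap.sum_apply, LinearMap.comp_apply, i, r, LinearMap.lTensor_tmul]
    conv_rhs => rw [← h3]
    simp [TensorProduct.tmul_sum]
  rw [h1, map_sum]
  simp_rw [LinearMap.trace_comp_comm' _ (r _), LinearMap.comp_assoc]
  rw [← map_sum]
  congr 1
  conv_rhs => rw [← LinearMap.comp_id Z, ← h2]
  exact LinearMap.ext fun w => by simp

theorem partialTrace_map_comp (x : E →ₗ[ℂ] E) (Z : E ⊗[ℂ] F →ₗ[ℂ] E ⊗[ℂ] F) :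
    partialTrace (TensorProduct.map x LinearMap.id ∘ₗ Z) = x ∘ₗ partialTrace Z := by
  have h (l : F →ₗ[ℂ] ℂ) (w : E ⊗[ℂ] F) :
      TensorProduct.rid ℂ E (LinearMap.lTensor E l (TensorProduct.map x LinearMap.id w)) =
        x (TensorProduct.rid ℂ E (LinearMap.lTensor E l w)) := by
    induction w with
    | zero => simp
    | add a b ha hb => simp only [map_add, ha, hb]
    | tmul e f => simp
  ext e
  simp only [partialTrace, LinearMap.sum_apply, LinearMap.comp_apply, map_sum,
    LinearEquiv.coe_coe]
  exact Finset.sum_congr rfl fun j _ => h _ _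

end TensorFactor

/-! ### The block algebras and their reduction -/

section BlockOperators

variable {α : Type*} [Fintype α]
  {Hu : α → Type*} [∀ a, NormedAddCommGroup (Hu a)] [∀ a, InnerProductSpace ℂ (Hu a)]
  [∀ a, FiniteDimensional ℂ (Hu a)]
  {Hub : α → Type*} [∀ a, NormedAddCommGroup (Hub a)] [∀ a, InnerProductSpace ℂ (Hub a)]
  [∀ a, FiniteDimensional ℂ (Hub a)]

@[simp]
theorem blockDiag_apply (X : ∀ a, Hu a ⊗[ℂ] Hub a →ₗ[ℂ] Hu a ⊗[ℂ] Hub a)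
    (ψ : UVSpace Hu Hub) (a : α) : blockDiag X ψ a = X a (ψ a) := rfl

theorem blockDiag_mul (X Y : ∀ a, Hu a ⊗[ℂ] Hub a →ₗ[ℂ] Hu a ⊗[ℂ] Hub a) :
    blockDiag X * blockDiag Y = blockDiag fun a => X a ∘ₗ Y a := rfl

theorem star_blockDiag (X : ∀ a, Hu a ⊗[ℂ] Hub a →ₗ[ℂ] Hu a ⊗[ℂ] Hub a) :
    star (blockDiag X) = blockDiag fun a => LinearMap.adjoint (X a) := by
  refine ((ContinuousLinearMap.eq_adjoint_iff _ _).mpr fun ψ χ => ?_).symm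
  simp [PiLp.inner_apply, LinearMap.adjoint_inner_left]

theorem leftOp_mul (x y : ∀ a, Hu a →ₗ[ℂ] Hu a) :
    (leftOp x * leftOp y : UVSpace Hu Hub →L[ℂ] _) = leftOp fun a => x a ∘ₗ y a := by
  simp only [leftOp, blockDiag_mul, ← TensorProduct.map_comp, LinearMap.id_comp]

theorem star_leftOp (x : ∀ a, Hu a →ₗ[ℂ] Hu a) :
    star (leftOp x : UVSpace Hu Hub →L[ℂ] _) = leftOp fun a => LinearMap.adjoint (x a) := by
  simp only [leftOp, star_blockDiag, TensorProduct.adjoint_map, LinearMap.adjoint_id]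

theorem leftOp_mul_rightOp_comm (x : ∀ a, Hu a →ₗ[ℂ] Hu a) (y : ∀ a, Hub a →ₗ[ℂ] Hub a) :
    (leftOp x * rightOp y : UVSpace Hu Hub →L[ℂ] _) = rightOp y * leftOp x := by
  simp only [leftOp, rightOp, blockDiag_mul, ← TensorProduct.map_comp, LinearMap.id_comp,
    LinearMap.comp_id]

open scoped Classical in
theorem diagBlock_apply (T : UVSpace Hu Hub →L[ℂ] UVSpace Hu Hub) (a : α)
    (v : Hu a ⊗[ℂ] Hub a) : diagBlock T a v = T (WithLp.toLp 2 (Pi.single a v)) a := rfl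

open scoped Classical in
theorem blockDiag_toLp_single (X : ∀ a, Hu a ⊗[ℂ] Hub a →ₗ[ℂ] Hu a ⊗[ℂ] Hub a) (a : α)
    (v : Hu a ⊗[ℂ] Hub a) :
    blockDiag X (WithLp.toLp 2 (Pi.single a v)) = WithLp.toLp 2 (Pi.single a (X a v)) := by
  ext b
  rcases eq_or_ne b a with rfl | h
  · simp
  · simp [h]

theorem diagBlock_blockDiag_mul (X : ∀ a, Hu a ⊗[ℂ] Hub a →ₗ[ℂ] Hu a ⊗[ℂ] Hub a)
    (T : UVSpace Hu Hub →L[ℂ] UVSpace Hu Hub) (a : α) :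
    diagBlock (blockDiag X * T) a = X a ∘ₗ diagBlock T a := rfl

theorem diagBlock_mul_blockDiag (X : ∀ a, Hu a ⊗[ℂ] Hub a →ₗ[ℂ] Hu a ⊗[ℂ] Hub a)
    (T : UVSpace Hu Hub →L[ℂ] UVSpace Hu Hub) (a : α) :
    diagBlock (T * blockDiag X) a = diagBlock T a ∘ₗ X a := by
  refine LinearMap.ext fun v => ?_
  rw [diagBlock_apply, mul_apply_eq_comp, blockDiag_toLp_single]
  rfl

-- Commuting with the block projections rules out off-diagonal blocks. These projections lie in both
-- A_u and A_ū, so each commutant computation reduces to single blocks.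
open scoped Classical in
theorem eq_blockDiag_diagBlock {T : UVSpace Hu Hub →L[ℂ] UVSpace Hu Hub}
    (h : ∀ a, T * blockDiag (Pi.single a LinearMap.id) = blockDiag (Pi.single a LinearMap.id) * T) :
    T = blockDiag (diagBlock T) := by
  ext ψ a
  have h1 : blockDiag (Pi.single a LinearMap.id) ψ = WithLp.toLp 2 (Pi.single a (ψ a)) := by
    ext b
    rcases eq_or_ne b a with rfl | hb
    · simp
    · simp [hb]
  have h2 := congr($(h a) ψ a)
  simp only [mul_apply_eq_comp, blockDiag_apply, Pi.single_eq_same, LinearMap.id_apply] at h2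
  rw [blockDiag_apply, diagBlock_apply, ← h1, h2]

theorem map_single_id [DecidableEq α] (a : α) :
    (fun b => TensorProduct.map ((Pi.single a LinearMap.id : ∀ a, Hu a →ₗ[ℂ] Hu a) b)
      (LinearMap.id : Hub b →ₗ[ℂ] Hub b)) = Pi.single a LinearMap.id := by
  ext1 b
  rcases eq_or_ne b a with rfl | hb
  · simp
  · simp [hb]

theorem id_map_single [DecidableEq α] (a : α) :
    (fun b => TensorProduct.map (LinearMap.id : Hu b →ₗ[ℂ] Hu b)
      ((Pi.single a LinearMap.id : ∀ a, Hub a →ₗ[ℂ] Hub a) b)) = Pi.single a LinearMap.id := by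
  ext1 b
  rcases eq_or_ne b a with rfl | hb
  · simp
  · simp [hb]

/-- The commutant of `A_ū` is contained in `A_u`. -/
theorem mem_algU_of_commute {T : UVSpace Hu Hub →L[ℂ] UVSpace Hu Hub}
    (h : ∀ y, T * rightOp y = rightOp y * T) : T ∈ algU Hu Hub := by
  classical
  have h1 : T = blockDiag (diagBlock T) := eq_blockDiag_diagBlock fun a => by
    simpa only [rightOp, id_map_single] using h (Pi.single a LinearMap.id)
  have h2 (a : α) : ∃ x : Hu a →ₗ[ℂ] Hu a, diagBlock T a = TensorProduct.map x LinearMap.id := by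
    refine exists_eq_map_id_of_commute fun y w => ?_
    have h3 := congr(diagBlock $(h (Pi.single a y)) a w)
    simpa [rightOp, diagBlock_mul_blockDiag, diagBlock_blockDiag_mul] using h3
  choose x hx using h2
  exact ⟨x, by rw [h1, leftOp]; congr 1; exact (funext hx).symm⟩

/-- The commutant of `A_u` is contained in `A_ū`. -/
theorem mem_algUbar_of_commute {T : UVSpace Hu Hub →L[ℂ] UVSpace Hu Hub}
    (h : ∀ x, T * leftOp x = leftOp x * T) : T ∈ algUbar Hu Hub := by
  classical
  have h1 : T = blockDiag (diagBlock T) := eq_blockDiag_diagBlock fun a => by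
    simpa only [leftOp, map_single_id] using h (Pi.single a LinearMap.id)
  have h2 (a : α) : ∃ y : Hub a →ₗ[ℂ] Hub a, diagBlock T a = TensorProduct.map LinearMap.id y := by
    refine exists_eq_id_map_of_commute fun y w => ?_
    have h3 := congr(diagBlock $(h (Pi.single a y)) a w)
    simpa [leftOp, diagBlock_mul_blockDiag, diagBlock_blockDiag_mul] using h3
  choose y hy using h2
  exact ⟨y, by rw [h1, rightOp]; congr 1; exact (funext hy).symm⟩

variable (Hu Hub) in
/-- The algebra `A_u`, as a von Neumann algebra. -/
noncomputable def vonNeumannU : VonNeumannAlgebra (UVSpace Hu Hub) := vN (algU Hu Hub)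

variable (Hu Hub) in
theorem coe_vonNeumannU : (vonNeumannU Hu Hub : Set (UVSpace Hu Hub →L[ℂ] _)) = algU Hu Hub := by
  ext X
  refine ⟨fun hX => mem_algU_of_commute fun y => ?_, fun hX => subset_vN hX⟩
  refine (mem_vN_iff.mp hX _ ?_).symm
  rintro _ ⟨x, rfl⟩
  exact ⟨leftOp_mul_rightOp_comm x y, by rw [star_leftOp, leftOp_mul_rightOp_comm]⟩

variable (Hu Hub) in
theorem coe_commutant_vonNeumannU :
    ((vonNeumannU Hu Hub).commutant : Set (UVSpace Hu Hub →L[ℂ] _)) = algUbar Hu Hub := by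
  rw [VonNeumannAlgebra.coe_commutant, coe_vonNeumannU]
  ext Y
  refine ⟨fun hY => mem_algUbar_of_commute fun x => (hY _ ⟨x, rfl⟩).symm, ?_⟩
  rintro ⟨y, rfl⟩ _ ⟨x, rfl⟩
  exact leftOp_mul_rightOp_comm x y

theorem mem_vonNeumannU {X : UVSpace Hu Hub →L[ℂ] UVSpace Hu Hub} :
    X ∈ vonNeumannU Hu Hub ↔ ∃ x, leftOp x = X := by
  rw [← SetLike.mem_coe, coe_vonNeumannU]
  rfl

open scoped Classical in
theorem opTrace_eq_sum_trace_diagBlock (T : UVSpace Hu Hub →L[ℂ] UVSpace Hu Hub) :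
    opTrace T = ∑ a, LinearMap.trace ℂ _ (diagBlock T a) := by
  let i (a : α) : Hu a ⊗[ℂ] Hub a →ₗ[ℂ] UVSpace Hu Hub :=
    (WithLp.linearEquiv 2 ℂ (∀ a, Hu a ⊗[ℂ] Hub a)).symm.toLinearMap ∘ₗ
      LinearMap.single ℂ (fun a => Hu a ⊗[ℂ] Hub a) a
  let p (a : α) : UVSpace Hu Hub →ₗ[ℂ] Hu a ⊗[ℂ] Hub a :=
    LinearMap.proj a ∘ₗ (WithLp.linearEquiv 2 ℂ (∀ a, Hu a ⊗[ℂ] Hub a)).toLinearMap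
  have h1 (a : α) : diagBlock T a = p a ∘ₗ (T.toLinearMap ∘ₗ i a) := rfl
  have h2 : ∑ a, i a ∘ₗ p a = LinearMap.id := by
    ext ψ b
    simp [i, p, Finset.sum_apply]
  simp_rw [h1, LinearMap.trace_comp_comm' _ (p _), LinearMap.comp_assoc]
  rw [← map_sum, opTrace_apply]
  congr 1
  conv_lhs => rw [← LinearMap.comp_id T.toLinearMap, ← h2]
  ext1 w
  simp

theorem opTrace_leftOp_mul (x : ∀ a, Hu a →ₗ[ℂ] Hu a)
    (ρ : UVSpace Hu Hub →L[ℂ] UVSpace Hu Hub) :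
    opTrace (leftOp x * ρ) =
      ∑ a, LinearMap.trace ℂ (Hu a) (x a ∘ₗ partialTrace (diagBlock ρ a)) := by
  rw [opTrace_eq_sum_trace_diagBlock]
  refine Finset.sum_congr rfl fun a _ => ?_
  rw [← partialTrace_map_comp, trace_partialTrace, leftOp, diagBlock_blockDiag_mul]

theorem opTrace_leftOp (x : ∀ a, Hu a →ₗ[ℂ] Hu a) :
    opTrace (leftOp x : UVSpace Hu Hub →L[ℂ] _) =
      ∑ a, LinearMap.trace ℂ (Hu a) (x a) * Module.finrank ℂ (Hub a) := by
  rw [opTrace_eq_sum_trace_diagBlock]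
  refine Finset.sum_congr rfl fun a _ => ?_
  have h : diagBlock (leftOp x : UVSpace Hu Hub →L[ℂ] _) a =
      TensorProduct.map (x a) LinearMap.id := by
    have := diagBlock_mul_blockDiag (fun a => TensorProduct.map (x a) LinearMap.id)
      (1 : UVSpace Hu Hub →L[ℂ] _) a
    rw [one_mul] at this
    refine this.trans ?_
    refine LinearMap.ext fun v => ?_
    simp [diagBlock_apply]
  rw [h, LinearMap.trace_tensorProduct', LinearMap.trace_id]

variable (Hu Hub) in
/-- The central element of `A_u` acting as multiplication by `c a` on the block `a`. -/
noncomputable def centralOp (c : α → ℂ) : UVSpace Hu Hub →L[ℂ] UVSpace Hu Hub :=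
  leftOp fun a => c a • LinearMap.id

@[simp]
theorem centralOp_apply (c : α → ℂ) (ψ : UVSpace Hu Hub) (a : α) :
    centralOp Hu Hub c ψ a = c a • ψ a := by
  simp [centralOp, leftOp, TensorProduct.map_smul_left]

theorem centralOp_mul (c d : α → ℂ) :
    centralOp Hu Hub c * centralOp Hu Hub d = centralOp Hu Hub (c * d) := by
  ext ψ a
  simp [mul_smul]

theorem centralOp_mul_leftOp (c : α → ℂ) (x : ∀ a, Hu a →ₗ[ℂ] Hu a) :
    centralOp Hu Hub c * leftOp x = leftOp fun a => c a • x a := by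
  rw [centralOp, leftOp_mul]
  rfl

theorem centralOp_mul_comm (c : α → ℂ) {X : UVSpace Hu Hub →L[ℂ] UVSpace Hu Hub}
    (hX : X ∈ vonNeumannU Hu Hub) : centralOp Hu Hub c * X = X * centralOp Hu Hub c := by
  obtain ⟨x, rfl⟩ := mem_vonNeumannU.mp hX
  rw [centralOp_mul_leftOp, centralOp, leftOp_mul]
  simp only [LinearMap.comp_smul, LinearMap.comp_id]

theorem star_centralOp (c : α → ℂ) :
    star (centralOp Hu Hub c) = centralOp Hu Hub (star c) := by
  rw [centralOp, star_leftOp, centralOp]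
  congr 1
  ext1 a
  rw [map_smulₛₗ, LinearMap.adjoint_id]
  rfl

variable (Hu Hub) in
/-- The functional `⨁ₐ xₐ ⊗ 1 ↦ ∑ₐ tr xₐ`. -/
noncomputable def reducedTrace : (UVSpace Hu Hub →L[ℂ] UVSpace Hu Hub) →ₗ[ℂ] ℂ :=
  weightedTrace (centralOp Hu Hub fun a => (Module.finrank ℂ (Hub a) : ℂ)⁻¹)

theorem partialTrace_eq_zero {E F : Type*}
    [NormedAddCommGroup E] [InnerProductSpace ℂ E] [FiniteDimensional ℂ E]
    [NormedAddCommGroup F] [InnerProductSpace ℂ F] [FiniteDimensional ℂ F]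
    (h : Module.finrank ℂ F = 0) (T : E ⊗[ℂ] F →ₗ[ℂ] E ⊗[ℂ] F) : partialTrace T = 0 := by
  have : IsEmpty (Fin (Module.finrank ℂ F)) := by rw [h]; infer_instance
  simp [partialTrace]

-- The weights of `reducedTrace` cancel the multiplicities dim Hub a in `opTrace_leftOp`. A
-- zero-dimensional Hub a gets weight 0⁻¹ = 0, harmlessly, since its block of H_UV is zero.
variable (Hu Hub) in
theorem isReduction_reduced :
    IsReduction (vonNeumannU Hu Hub) (reducedTrace Hu Hub) reduced where
  mem ρ := mem_vonNeumannU.mpr ⟨_, rfl⟩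
  opTrace_mul X hX ρ := by
    obtain ⟨x, rfl⟩ := mem_vonNeumannU.mp hX
    rw [opTrace_leftOp_mul, reducedTrace, weightedTrace_apply, reduced,
      leftOp_mul, centralOp_mul_leftOp, opTrace_leftOp]
    refine Finset.sum_congr rfl fun a _ => ?_
    by_cases h : Module.finrank ℂ (Hub a) = 0
    · simp [partialTrace_eq_zero h]
    · have h' : (Module.finrank ℂ (Hub a) : ℂ) ≠ 0 := by exact_mod_cast h
      rw [map_smul, smul_eq_mul]
      field_simp
  faithful X hX h := by
    -- With V = d⁻¹ central and self-adjoint, the weight is V², so φ(X*X) is the trace of (XV)*XV,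
    -- and V is invertible on H_UV.
    set d : α → ℂ := fun a => ((Real.sqrt (Module.finrank ℂ (Hub a)) : ℝ) : ℂ) with hd
    have hdd (a : α) : d a * d a = Module.finrank ℂ (Hub a) := by
      rw [hd, ← Complex.ofReal_mul, Real.mul_self_sqrt (by positivity)]
      simp
    set V := centralOp Hu Hub d⁻¹ with hV
    have hVs : star V = V := by
      rw [hV, star_centralOp]
      congr 1
      ext a
      simp [hd]
    have hVV : centralOp Hu Hub (fun a => (Module.finrank ℂ (Hub a) : ℂ)⁻¹) = V * V := by
      rw [hV, centralOp_mul]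
      congr 1
      ext a
      simp [← hdd]
    have hXV : X * V = 0 := by
      apply eq_zero_of_opTrace_star_mul_self
      rw [← h, reducedTrace, weightedTrace_apply, hVV, mul_assoc,
        opTrace_mul_comm V, star_mul, hVs]
      simp only [mul_assoc]
    have hVd : V * centralOp Hu Hub d = 1 := by
      rw [hV, centralOp_mul]
      ext ψ a
      rw [centralOp_apply]
      by_cases h : Module.finrank ℂ (Hub a) = 0
      · have : Subsingleton (Hub a) := Module.finrank_zero_iff.mp h
        have hsub : Subsingleton (Hu a ⊗[ℂ] Hub a) := by
          apply Module.finrank_zero_iff (R := ℂ).mp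
          rw [Module.finrank_tensorProduct, h, mul_zero]
        exact Subsingleton.elim _ _
      · have hda : d a ≠ 0 := fun h0 =>
          h ((Nat.cast_eq_zero (R := ℂ)).mp (by rw [← hdd a, h0, mul_zero]))
        simp [hda]
    rw [← mul_one X, ← hVd, ← mul_assoc, hXV, zero_mul]
  tracial X hX Y hY := by
    simp only [reducedTrace, weightedTrace_apply]
    rw [← mul_assoc, opTrace_mul_comm, ← mul_assoc, ← centralOp_mul_comm _ hY, mul_assoc]
  map_star X hX := by
    simp only [reducedTrace, weightedTrace_apply]
    rw [← opTrace_star, star_mul, star_centralOp, opTrace_mul_comm]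
    congr 3
    ext a
    simp

end BlockOperators

/-! ### The iteration and the main theorem -/

section Stages

variable {α : Type*} [Fintype α]
  {Hu : α → Type*} [∀ a, NormedAddCommGroup (Hu a)] [∀ a, InnerProductSpace ℂ (Hu a)]
  [∀ a, FiniteDimensional ℂ (Hu a)]
  {Hub : α → Type*} [∀ a, NormedAddCommGroup (Hub a)] [∀ a, InnerProductSpace ℂ (Hub a)]
  [∀ a, FiniteDimensional ℂ (Hub a)]

theorem apply_mem_enlarge {K : Submodule ℂ (UVSpace Hu Hub)}
    {X : UVSpace Hu Hub →L[ℂ] UVSpace Hu Hub} (hX : X ∈ seedAlgebra K) {ψ : UVSpace Hu Hub}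
    (hψ : ψ ∈ K) : X ψ ∈ enlarge K :=
  Submodule.subset_span ⟨X, hX, ψ, hψ, rfl⟩

theorem le_enlarge (K : Submodule ℂ (UVSpace Hu Hub)) : K ≤ enlarge K :=
  fun _ hψ => apply_mem_enlarge (one_mem (seedAlgebra K)) hψ

theorem stage_succ (S : Set (UVSpace Hu Hub)) (n : ℕ) :
    stage S (n + 1) = enlarge (stage S n) :=
  Function.iterate_succ_apply' _ _ _

theorem monotone_stage (S : Set (UVSpace Hu Hub)) : Monotone (stage S) :=
  monotone_nat_of_le_succ fun n => by
    rw [stage_succ]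
    exact le_enlarge _

theorem exists_stage_eq_preSpace (S : Set (UVSpace Hu Hub)) :
    ∃ N, ∀ n, N ≤ n → stage S n = preSpace S := by
  obtain ⟨N, hN⟩ := WellFoundedGT.monotone_chain_condition ⟨stage S, monotone_stage S⟩
  refine ⟨N, fun n hn => le_antisymm (le_iSup (stage S) n) (iSup_le fun m => ?_)⟩
  calc stage S m ≤ stage S (max N m) := monotone_stage S (le_max_right _ _)
    _ = stage S N := (hN _ (le_max_left _ _)).symm
    _ ≤ stage S n := monotone_stage S hn

theorem enlarge_preSpace (S : Set (UVSpace Hu Hub)) : enlarge (preSpace S) = preSpace S := by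
  obtain ⟨N, hN⟩ := exists_stage_eq_preSpace S
  rw [← hN N le_rfl, ← stage_succ, hN N le_rfl, hN (N + 1) (Nat.le_succ N)]

theorem subset_preSpace (S : Set (UVSpace Hu Hub)) : S ⊆ preSpace S :=
  Submodule.subset_span.trans (le_iSup (stage S) 0)

/-- By induction each stage L lies in K, and the ratios on L preserve all of K, in particular L's
image. -/
theorem preSpace_le_of_complementaryRecovery {S : Set (UVSpace Hu Hub)}
    {K : Submodule ℂ (UVSpace Hu Hub)} (hS : S ⊆ K) {B : VonNeumannAlgebra K}
    (hB : ComplementaryRecovery K B (algU Hu Hub) (algUbar Hu Hub)) : preSpace S ≤ K := by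
  rw [← coe_vonNeumannU, ← coe_commutant_vonNeumannU] at hB
  refine iSup_le fun n => ?_
  induction n with
  | zero => exact Submodule.span_le.mpr hS
  | succ n ih =>
    rw [stage_succ]
    refine Submodule.span_le.mpr ?_
    rintro _ ⟨X, hX, ψ, hψ, rfl⟩
    exact (isReduction_reduced Hu Hub).apply_mem_of_complementaryRecovery hB ih hX (ih hψ)

end Stages

end HolographicCode

theorem mainTheorem1 {α : Type*} [Fintype α]
    (Hu : α → Type*) [∀ a, NormedAddCommGroup (Hu a)] [∀ a, InnerProductSpace ℂ (Hu a)]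
    [∀ a, FiniteDimensional ℂ (Hu a)]
    (Hub : α → Type*) [∀ a, NormedAddCommGroup (Hub a)] [∀ a, InnerProductSpace ℂ (Hub a)]
    [∀ a, FiniteDimensional ℂ (Hub a)]
    (S : Set (HolographicCode.UVSpace Hu Hub)) :
    -- the iteration terminates, and `preSpace S` is its final space
    (∃ N, ∀ n, N ≤ n → HolographicCode.stage S n = HolographicCode.preSpace S) ∧
    -- `A_u^pre` acts within the final space
    (∀ X ∈ HolographicCode.preAlgebra S, ∀ ψ ∈ HolographicCode.preSpace S,
      X ψ ∈ HolographicCode.preSpace S) ∧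
    -- the restriction of `A_u^pre` to the final space has complementary recovery
    (∃ Ar : VonNeumannAlgebra (HolographicCode.preSpace S),
      (∀ T : HolographicCode.preSpace S →L[ℂ] HolographicCode.preSpace S,
        T ∈ Ar ↔ ∃ X ∈ HolographicCode.preAlgebra S, ∀ ψ : HolographicCode.preSpace S,
          (T ψ : HolographicCode.UVSpace Hu Hub) = X ψ) ∧
      HolographicCode.ComplementaryRecovery (HolographicCode.preSpace S) Ar
        (HolographicCode.algU Hu Hub) (HolographicCode.algUbar Hu Hub)) ∧
    -- the final space is the smallest extension of the seed states with complementary recovery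
    IsLeast {K : Submodule ℂ (HolographicCode.UVSpace Hu Hub) |
        S ⊆ K ∧ ∃ B : VonNeumannAlgebra K,
          HolographicCode.ComplementaryRecovery K B
            (HolographicCode.algU Hu Hub) (HolographicCode.algUbar Hu Hub)}
      (HolographicCode.preSpace S) := by
  have hinv : ∀ X ∈ HolographicCode.preAlgebra S, ∀ ψ ∈ HolographicCode.preSpace S,
      X ψ ∈ HolographicCode.preSpace S := fun X hX ψ hψ => by
    have h := HolographicCode.apply_mem_enlarge hX hψ
    rwa [HolographicCode.enlarge_preSpace] at h
  -- For R = `reduced`, `ratioAlgebra` unfolds to `seedAlgebra`, so `hinv` is exactly the invariance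
  -- required.
  have hrec := (HolographicCode.isReduction_reduced Hu Hub).exists_restriction_complementaryRecovery
    hinv
  rw [HolographicCode.coe_vonNeumannU, HolographicCode.coe_commutant_vonNeumannU] at hrec
  obtain ⟨Ar, hAr⟩ := hrec
  exact ⟨HolographicCode.exists_stage_eq_preSpace S, hinv, ⟨Ar, hAr⟩,
    ⟨HolographicCode.subset_preSpace S, Ar, hAr.2⟩,
    fun K hK => hK.2.elim fun _ hB => HolographicCode.preSpace_le_of_complementaryRecovery hK.1 hB⟩
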